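/- **Partial Horn theories.** Fix a set $\mathcal S_0$ of basic sorts with a distinguished element $ctx$, and let $\mathcal S=\mathcal S_0\times\mathbb N$ be the set of sorts. A theory consists of function symbols $\sigma:s_1\times\dots\times s_k\to s$, predicate symbols $R:s_1\times\dots\times s_k$ and a set of Horn sequents $\varphi\vdash_V\psi$ ($\varphi,\psi$ finite conjunctions of atomic formulas $t=t'$, $R(t_1,\dots,t_k)$ with variables in the finite list $V$). Theorems are the sequents derivable in partial Horn logic; $t{\downarrow}$ means $t=t$. A restricted term $t|_\varphi$ is a term with a formula; $t|_\varphi{\downarrow}$ means $t{\downarrow}\wedge\varphi$, and $t|_\varphi$ and $t'|_{\varphi'}$ are equivalent if $t{\downarrow}\wedge\varphi\vdash t=t'\wedge\varphi'$ and $t'{\downarrow}\wedge\varphi'\vdash t=t'\wedge\varphi$ are derivable. An interpretation $f:\mathbb T\to\mathbb T'$ assigns to every function symbol $\sigma$ of $\mathbb T$ a restricted term $f(\sigma)$ of $\mathbb T'$ of the same sort, and to every predicate symbol $R$ a formula $f(R)$ of $\mathbb T'$, whose free variables are exactly $x_1:s_1,\dots,x_k:s_k$, such that the axioms of $\mathbb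 T$ become theorems of $\mathbb T'$. Two interpretations are equivalent if they send each symbol to equivalent restricted terms or formulas; a morphism of theories is an equivalence class of interpretations. **Base theory and $L$.** The base theory $\mathbb T_{\mathcal S_0}$ has symbols $*:(ctx,0)$, $ft_n:(ctx,n+1)\to(ctx,n)$, $ctx_{p,n}:(p,n)\to(ctx,n)$ and axioms $\vdash *{\downarrow}$, $\vdash_x x=*$, $\vdash_x ctx_{ctx,n}(x)=x$. A theory under it is a theory $\mathbb T$ with an interpretation $u:\mathbb T_{\mathcal S_0}\to\mathbb T$. Write $L(p,n)=(p,n+1)$. The theory $L(\mathbb T)$ has the symbols and axioms of $\mathbb T_{\mathcal S_0}$, a symbol $L(\sigma):(ctx,1)\times L(s_1)\times\dots\times L(s_k)\to L(s)$ for every function symbol $\sigma:s_1\times\dots\times s_k\to s$ of $\mathbb T$ and a symbol $L(R):(ctx,1)\times L(s_1)\times\dots\times L(s_k)$ for every predicate symbol $R:s_1\times\dots\times s_k$ of $\mathbb T$, where $s_i=(p_i,n_i)$ and $s=(p,n)$. For a term $t$, formula $\varphi$ or restricted term of $\mathbb T$ and a variable $\Gamma:(ctx,1)$, define $L(\Gamma,t)$,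 $L(\Gamma,\varphi)$, $L(\Gamma,t|_\varphi)=L(\Gamma,t)|_{L(\Gamma,\varphi)}$ by $L(\Gamma,x)=x|_{ft^n(ctx_{p,n+1}(x))=\Gamma}$ for a variable $x$ of sort $(p,n)$ in $\mathbb T$, $L(\Gamma,\sigma(t_1,\dots,t_k))=L(\sigma)(\Gamma,L(\Gamma,t_1),\dots,L(\Gamma,t_k))$, and likewise for atomic formulas and conjunctions. The further axioms of $L(\mathbb T)$ are - $ft^n(ctx_{p,n+1}(x))=\Gamma\ \vdash_{\Gamma,x}\ ctx_{p,n+1}(x)=L(\Gamma,u(ctx_{p,n})(x))$ for all $p,n$; - $L(\sigma)(\Gamma,x_1,\dots,x_k){\downarrow}\ \vdash\ ft^{n}(ctx_{p,n+1}(L(\sigma)(\Gamma,x_1,\dots,x_k)))=\Gamma$ and $L(\sigma)(\Gamma,x_1,\dots,x_k){\downarrow}\ \vdash\ ft^{n_i}(ctx_{p_i,n_i+1}(x_i))=\Gamma$ for all $\sigma$ and $i$; - $L(R)(\Gamma,x_1,\dots,x_k)\ \vdash\ ft^{n_i}(ctx_{p_i,n_i+1}(x_i))=\Gamma$ for all $R$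 and $i$. For an interpretation $f$, $L(f)$ fixes the base symbols and sends $L(\sigma)(\Gamma,x_1,\dots,x_k)$ to $L(\Gamma,f(\sigma)(x_1,\dots,x_k))$ and $L(R)(\Gamma,x_1,\dots,x_k)$ to $L(\Gamma,f(R)(x_1,\dots,x_k))$. **Prestable theories.** A prestable theory is an algebra for $L$: a theory $\mathbb T$ under $\mathbb T_{\mathcal S_0}$ with a morphism $\alpha:L(\mathbb T)\to\mathbb T$ under $\mathbb T_{\mathcal S_0}$. A morphism of prestable theories $\mathbb T\to\mathbb T'$ is a morphism of theories under $\mathbb T_{\mathcal S_0}$ that is represented by an interpretation $f$ with $f\circ\alpha=\alpha'\circ L(f)$ (up to equivalence). **Contextual theories.** Let $\mathbb T_b$ be a prestable theory. A contextual theory under $\mathbb T_b$ is a prestable theory $\mathbb T$ such that, for some sets $\mathcal F_0$, $\mathcal P_0$ of basic function and predicate symbols, no symbol in $\mathcal F_0$ having target sort $(ctx,0)$: 1. the function symbols of $\mathbb T$ are those of $\mathbb T_b$ together with $\sigma_m:(ctx,m)\times(p_1,n_1+m)\times\dots\times(p_k,n_k+m)\to(p,n+m)$ for every $\sigma:(p_1,n_1)\times\dots\times(p_k,n_k)\to(p,n)$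 in $\mathcal F_0$ and $m\in\mathbb N$; 2. the predicate symbols of $\mathbb T$ are those of $\mathbb T_b$ together with $R_m:(ctx,m)\times(p_1,n_1+m)\times\dots\times(p_k,n_k+m)$ for every $R:(p_1,n_1)\times\dots\times(p_k,n_k)$ in $\mathcal P_0$ and $m\in\mathbb N$; 3. every axiom of $\mathbb T_b$ is an axiom of $\mathbb T$, and the structure map from $\mathbb T_{\mathcal S_0}$ is that of $\mathbb T_b$; 4. $\alpha$ is defined on the symbols of $\mathbb T_b$ as in $\mathbb T_b$, and $$\alpha(L(\sigma_m)(\Gamma,\Delta,x_1,\dots,x_k))=\sigma_{m+1}(\Delta,x_1,\dots,x_k)|_{ft^m(\Delta)=\Gamma},$$ $$\alpha(L(R_m)(\Gamma,\Delta,x_1,\dots,x_k))=R_{m+1}(\Delta,x_1,\dots,x_k)\wedge ft^m(\Delta)=\Gamma.$$ **Lemma.** Let $\mathbb T_b$ be a prestable theory in which the empty context can be extended, that is, $\vdash_\Gamma \alpha(L(\Gamma,*)){\downarrow}$ is derivable in $\mathbb T_b$ (where $*$ stands for its image under $u$). Then for every prestable theory $\mathbb T$ with a morphism of prestable theories $\mathbb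 T_b\to\mathbb T$ there is a contextual theory $\mathbb T'$ under $\mathbb T_b$ such that the inclusion $\mathbb T_b\to\mathbb T'$ is a morphism of prestable theories and $\mathbb T$ is isomorphic to $\mathbb T'$ by an isomorphism of prestable theories that commutes with the morphisms from $\mathbb T_b$. -/

import Mathlib

universe u

/-! ### Partial Horn logic over a fixed set of sorts -/

namespace PartialHorn

/-- A finite list of sorted variables `x₀ : s₀, …, xₖ₋₁ : sₖ₋₁`; also used for arities. -/
structure Ctx (S : Type u) : Type u where
  len : ℕ
  sort : Fin len → S

/-- The empty list of variables. -/
abbrev Ctx.empty (S : Type u) : Ctx S := ⟨0, Fin.elim0⟩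

/-- A single variable of sort `s`. -/
abbrev Ctx.single {S : Type u} (s : S) : Ctx S := ⟨1, fun _ => s⟩

/-- One more variable, of sort `s`, put in front of `V`. -/
abbrev Ctx.cons {S : Type u} (s : S) (V : Ctx S) : Ctx S := ⟨V.len + 1, Fin.cons s V.sort⟩

/-- A many-sorted first-order signature with set of sorts `S`. -/
structure Signature (S : Type u) : Type (u + 1) where
  /-- function symbols `σ : dom σ → cod σ` -/
  Func : Type u
  /-- predicate symbols `R : pdom R` -/
  Pred : Type u
  dom : Func → Ctx S
  cod : Func → S
  pdom : Pred → Ctx S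

/-- Terms with variables in `V`, indexed by their sort. -/
inductive Term {S : Type u} (Sg : Signature S) (V : Ctx S) : S → Type u
  | var (x : Fin V.len) : Term Sg V (V.sort x)
  | app (σ : Sg.Func) (ts : ∀ i : Fin (Sg.dom σ).len, Term Sg V ((Sg.dom σ).sort i)) :
      Term Sg V (Sg.cod σ)

/-- Horn formulas with variables in `V`: finite conjunctions of atomic formulas. -/
inductive Formula {S : Type u} (Sg : Signature S) (V : Ctx S) : Type u
  | top : Formula Sg V
  | and (φ ψ : Formula Sg V) : Formula Sg V
  | eq {s : S} (t t' : Term Sg V s) : Formula Sg V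
  | rel (R : Sg.Pred) (ts : ∀ i : Fin (Sg.pdom R).len, Term Sg V ((Sg.pdom R).sort i)) :
      Formula Sg V

section Terms

variable {S : Type u} {Sg : Signature S} {V W : Ctx S}

/-- Simultaneous substitution. -/
def Term.subst (θ : ∀ x : Fin V.len, Term Sg W (V.sort x)) :
    ∀ {s : S}, Term Sg V s → Term Sg W s
  | _, .var x => θ x
  | _, .app σ ts => .app σ (fun i => (ts i).subst θ)

/-- Simultaneous substitution in a formula. -/
def Formula.subst (θ : ∀ x : Fin V.len, Term Sg W (V.sort x)) : Formula Sg V → Formula Sg W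
  | .top => .top
  | .and φ ψ => .and (φ.subst θ) (ψ.subst θ)
  | .eq t t' => .eq (t.subst θ) (t'.subst θ)
  | .rel R ts => .rel R (fun i => (ts i).subst θ)

/-- Free variables of a term. -/
def Term.fv : ∀ {s : S}, Term Sg V s → Set (Fin V.len)
  | _, .var x => {x}
  | _, .app _ ts => ⋃ i, (ts i).fv

/-- Free variables of a formula. -/
def Formula.fv : Formula Sg V → Set (Fin V.len)
  | .top => ∅
  | .and φ ψ => φ.fv ∪ ψ.fv
  | .eq t t' => t.fv ∪ t'.fv
  | .rel _ ts => ⋃ i, (ts i).fv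

/-- The term is a variable. -/
def Term.IsVar : ∀ {s : S}, Term Sg V s → Prop
  | _, .var _ => True
  | _, .app _ _ => False

/-- `t↓`, that is `t = t`. -/
def Term.defined {s : S} (t : Term Sg V s) : Formula Sg V := .eq t t

/-- Conjunction of a finite family of formulas. -/
def Formula.conj : ∀ {n : ℕ}, (Fin n → Formula Sg V) → Formula Sg V
  | 0, _ => .top
  | _ + 1, φ => .and (φ 0) (Formula.conj (fun i => φ i.succ))

/-- The substitution of `t` for the first variable of `Ctx.cons s V`, fixing the others. -/
def instFirst {s : S} (t : Term Sg V s) : ∀ x : Fin (Ctx.cons s V).len,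
    Term Sg V ((Ctx.cons s V).sort x) :=
  Fin.cases (motive := fun x => Term Sg V ((Ctx.cons s V).sort x)) t (fun i => .var i)

end Terms

/-- A sequent `φ ⊢_V ψ`. -/
structure Sequent {S : Type u} (Sg : Signature S) : Type u where
  V : Ctx S
  lhs : Formula Sg V
  rhs : Formula Sg V

/-- A partial Horn theory with set of sorts `S`. -/
structure Theory (S : Type u) : Type (u + 1) where
  sig : Signature S
  ax : Set (Sequent sig)

/-- Derivability of `φ ⊢_V ψ` in partial Horn logic from a set of axioms. -/
inductive Derivable {S : Type u} {Sg : Signature S} (A : Set (Sequent Sg)) :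
    ∀ {V : Ctx S}, Formula Sg V → Formula Sg V → Prop
  | ax {V : Ctx S} {φ ψ : Formula Sg V} (h : (⟨V, φ, ψ⟩ : Sequent Sg) ∈ A) : Derivable A φ ψ
  | refl {V : Ctx S} (φ : Formula Sg V) : Derivable A φ φ
  | cut {V : Ctx S} {φ ψ χ : Formula Sg V} (h₁ : Derivable A φ ψ) (h₂ : Derivable A ψ χ) :
      Derivable A φ χ
  | top {V : Ctx S} (φ : Formula Sg V) : Derivable A φ .top
  | and_left {V : Ctx S} (φ ψ : Formula Sg V) : Derivable A (.and φ ψ) φ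
  | and_right {V : Ctx S} (φ ψ : Formula Sg V) : Derivable A (.and φ ψ) ψ
  | and_intro {V : Ctx S} {φ ψ χ : Formula Sg V} (h₁ : Derivable A φ ψ) (h₂ : Derivable A φ χ) :
      Derivable A φ (.and ψ χ)
  /-- variables are defined -/
  | var_defined {V : Ctx S} (x : Fin V.len) :
      Derivable A .top (Term.defined (.var x : Term Sg V (V.sort x)))
  /-- replacing equals by equals: `t = t' ∧ φ[t/x] ⊢ φ[t'/x]` -/
  | replace {V : Ctx S} {s : S} (t t' : Term Sg V s) (φ : Formula Sg (Ctx.cons s V)) :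
      Derivable A (.and (.eq t t') (φ.subst (instFirst t))) (φ.subst (instFirst t'))
  /-- substitution, where a term that is not a variable may be substituted only for a variable
  that is free in the antecedent; it contains weakening of the list of variables -/
  | subst {V W : Ctx S} {φ ψ : Formula Sg V} (θ : ∀ x : Fin V.len, Term Sg W (V.sort x))
      (hθ : ∀ x, x ∈ φ.fv ∨ (θ x).IsVar) (h : Derivable A φ ψ) :
      Derivable A (φ.subst θ) (ψ.subst θ)

/-- A restricted term `t|_φ`. -/
structure RTerm {S : Type u} (Sg : Signature S) (V : Ctx S) (s : S) : Type u where
  tm : Term Sg V s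
  cond : Formula Sg V

section Translations

variable {S : Type u} {Sg Sg' Sg'' : Signature S} {V : Ctx S}

/-- `t|_φ↓`. -/
def RTerm.defined {s : S} (r : RTerm Sg V s) : Formula Sg V := .and r.tm.defined r.cond

/-- Free variables of a restricted term. -/
def RTerm.fv {s : S} (r : RTerm Sg V s) : Set (Fin V.len) := r.tm.fv ∪ r.cond.fv

/-- Equivalence `⊢_V t|_φ ≅ t'|_φ'` of restricted terms. -/
def RTerm.Equiv (A : Set (Sequent Sg)) {s : S} (r r' : RTerm Sg V s) : Prop :=
  Derivable A r.defined (.and (.eq r.tm r'.tm) r'.cond) ∧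
  Derivable A r'.defined (.and (.eq r.tm r'.tm) r.cond)

/-- Equivalence of formulas. -/
def Formula.Equiv (A : Set (Sequent Sg)) (φ ψ : Formula Sg V) : Prop :=
  Derivable A φ ψ ∧ Derivable A ψ φ

/-- An assignment of a restricted term to every function symbol and of a formula to every
predicate symbol, in the variables given by the arity of the symbol. -/
structure Translation {S : Type u} (Sg Sg' : Signature S) : Type u where
  func : ∀ σ : Sg.Func, RTerm Sg' (Sg.dom σ) (Sg.cod σ)
  pred : ∀ R : Sg.Pred, Formula Sg' (Sg.pdom R)

/-- Extension of a translation to terms. -/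
def Translation.mapTerm (f : Translation Sg Sg') : ∀ {s : S}, Term Sg V s → RTerm Sg' V s
  | _, .var x => ⟨.var x, .top⟩
  | _, .app σ ts =>
      ⟨(f.func σ).tm.subst (fun i => (f.mapTerm (ts i)).tm),
        .and ((f.func σ).cond.subst (fun i => (f.mapTerm (ts i)).tm))
          (.conj fun i => (f.mapTerm (ts i)).cond)⟩

/-- Extension of a translation to formulas. -/
def Translation.mapFormula (f : Translation Sg Sg') : Formula Sg V → Formula Sg' V
  | .top => .top
  | .and φ ψ => .and (f.mapFormula φ) (f.mapFormula ψ)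
  | .eq t t' => .and (.eq (f.mapTerm t).tm (f.mapTerm t').tm)
      (.and (f.mapTerm t).cond (f.mapTerm t').cond)
  | .rel R ts => .and ((f.pred R).subst (fun i => (f.mapTerm (ts i)).tm))
      (.conj fun i => (f.mapTerm (ts i)).cond)

/-- Extension of a translation to restricted terms: `f(t|_φ) = f(t)|_{f(φ)}`. -/
def Translation.mapRTerm (f : Translation Sg Sg') {s : S} (r : RTerm Sg V s) : RTerm Sg' V s :=
  ⟨(f.mapTerm r.tm).tm, .and (f.mapTerm r.tm).cond (f.mapFormula r.cond)⟩

/-- The identity translation. -/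
def Translation.id (Sg : Signature S) : Translation Sg Sg where
  func σ := ⟨.app σ (fun i => .var i), .top⟩
  pred R := .rel R (fun i => .var i)

/-- The composite `g ∘ f`. -/
def Translation.comp (g : Translation Sg' Sg'') (f : Translation Sg Sg') :
    Translation Sg Sg'' where
  func σ := g.mapRTerm (f.func σ)
  pred R := g.mapFormula (f.pred R)

/-- Equivalence of translations into a theory with axioms `A`. -/
def Translation.Equiv (A : Set (Sequent Sg')) (f g : Translation Sg Sg') : Prop :=
  (∀ σ, (f.func σ).Equiv A (g.func σ)) ∧ (∀ R, (f.pred R).Equiv A (g.pred R))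

end Translations

/-- A translation is an interpretation of `T` in `T'` if all the variables of a symbol occur in
its translation and the axioms of `T` become theorems of `T'`. Morphisms of theories are
equivalence classes of interpretations. -/
structure IsInterpretation {S : Type u} (T T' : Theory S) (f : Translation T.sig T'.sig) :
    Prop where
  fv_func : ∀ σ, (f.func σ).fv = Set.univ
  fv_pred : ∀ R, (f.pred R).fv = Set.univ
  ax : ∀ q ∈ T.ax, Derivable T'.ax (f.mapFormula q.lhs) (f.mapFormula q.rhs)

section Sum

variable {S : Type u}

/-- The disjoint union of two signatures. -/
abbrev Signature.sum (Sg Sg' : Signature S) : Signature S where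
  Func := Sg.Func ⊕ Sg'.Func
  Pred := Sg.Pred ⊕ Sg'.Pred
  dom := Sum.elim Sg.dom Sg'.dom
  cod := Sum.elim Sg.cod Sg'.cod
  pdom := Sum.elim Sg.pdom Sg'.pdom

variable {Sg Sg' : Signature S} {V : Ctx S}

/-- A term of the first signature, as a term of the union. -/
def Term.inl : ∀ {s : S}, Term Sg V s → Term (Sg.sum Sg') V s
  | _, .var x => .var x
  | _, .app σ ts => .app (Sg := Sg.sum Sg') (Sum.inl σ) (fun i => (ts i).inl)

/-- A term of the second signature, as a term of the union. -/
def Term.inr : ∀ {s : S}, Term Sg' V s → Term (Sg.sum Sg') V s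
  | _, .var x => .var x
  | _, .app σ ts => .app (Sg := Sg.sum Sg') (Sum.inr σ) (fun i => (ts i).inr)

/-- A formula of the first signature, as a formula of the union. -/
def Formula.inl : Formula Sg V → Formula (Sg.sum Sg') V
  | .top => .top
  | .and φ ψ => .and φ.inl ψ.inl
  | .eq t t' => .eq t.inl t'.inl
  | .rel R ts => .rel (Sg := Sg.sum Sg') (Sum.inl R) (fun i => (ts i).inl)

/-- A formula of the second signature, as a formula of the union. -/
def Formula.inr : Formula Sg' V → Formula (Sg.sum Sg') V
  | .top => .top
  | .and φ ψ => .and φ.inr ψ.inr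
  | .eq t t' => .eq t.inr t'.inr
  | .rel R ts => .rel (Sg := Sg.sum Sg') (Sum.inr R) (fun i => (ts i).inr)

/-- A restricted term of the first signature, as one of the union. -/
def RTerm.inl {s : S} (r : RTerm Sg V s) : RTerm (Sg.sum Sg') V s := ⟨r.tm.inl, r.cond.inl⟩

/-- A sequent of the first signature, as one of the union. -/
def Sequent.inl (q : Sequent Sg) : Sequent (Sg.sum Sg') := ⟨q.V, q.lhs.inl, q.rhs.inl⟩

/-- A sequent of the second signature, as one of the union. -/
def Sequent.inr (q : Sequent Sg') : Sequent (Sg.sum Sg') := ⟨q.V, q.lhs.inr, q.rhs.inr⟩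

/-- The inclusion of the first signature into the union. -/
def Translation.inl (Sg Sg' : Signature S) : Translation Sg (Sg.sum Sg') where
  func σ := ((Translation.id Sg).func σ).inl
  pred R := ((Translation.id Sg).pred R).inl

/-- The inclusion of the second signature into the union. -/
def Translation.inr (Sg Sg' : Signature S) : Translation Sg' (Sg.sum Sg') where
  func σ := .mk (.app (Sg := Sg.sum Sg') (Sum.inr σ) (fun i => .var i)) .top
  pred R := .rel (Sg := Sg.sum Sg') (Sum.inr R) (fun i => .var i)

end Sum

/-! ### The theory of contexts and the context extension `L`

The sorts are pairs `(p, n)` of a basic sort and the length of a context; `c` is the basic sort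
of contexts. -/

section Extension

variable {S₀ : Type u}

/-- The sort `(p, n + m)`. -/
abbrev shift (m : ℕ) (s : S₀ × ℕ) : S₀ × ℕ := (s.1, s.2 + m)

/-- The arity `(c, m) × (p₁, n₁ + m) × … × (pₖ, nₖ + m)`. -/
abbrev Ctx.ext (c : S₀) (m : ℕ) (V : Ctx (S₀ × ℕ)) : Ctx (S₀ × ℕ) :=
  Ctx.cons (c, m) ⟨V.len, fun i => shift m (V.sort i)⟩

/-- The symbols `*`, `ftₙ` and `ctx_{p,n}`. -/
inductive BaseFunc (S₀ : Type u) : Type u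
  | star : BaseFunc S₀
  | ft (n : ℕ) : BaseFunc S₀
  | ctx (p : S₀) (n : ℕ) : BaseFunc S₀

/-- `* : (c, 0)`, `ftₙ : (c, n + 1) → (c, n)` and `ctx_{p,n} : (p, n) → (c, n)`. -/
abbrev baseSig (c : S₀) : Signature (S₀ × ℕ) where
  Func := BaseFunc S₀
  Pred := PEmpty
  dom
    | .star => Ctx.empty _
    | .ft n => Ctx.single (c, n + 1)
    | .ctx p n => Ctx.single (p, n)
  cod
    | .star => (c, 0)
    | .ft n => (c, n)
    | .ctx _ n => (c, n)
  pdom R := R.elim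

section BaseTerms

variable {c : S₀} {V : Ctx (S₀ × ℕ)}

/-- The term `*`. -/
def baseStar : Term (baseSig c) V (c, 0) :=
  .app (Sg := baseSig c) BaseFunc.star (fun i => Fin.elim0 i)

/-- The term `ftₙ(t)`. -/
def baseFt (n : ℕ) (t : Term (baseSig c) V (c, n + 1)) : Term (baseSig c) V (c, n) :=
  .app (Sg := baseSig c) (BaseFunc.ft n) (fun _ => t)

/-- The term `ctx_{p,n}(t)`. -/
def baseCtx (p : S₀) (n : ℕ) (t : Term (baseSig c) V (p, n)) : Term (baseSig c) V (c, n) :=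
  .app (Sg := baseSig c) (BaseFunc.ctx p n) (fun _ => t)

/-- The iterate `ftⁿ : (c, n + 1) → (c, 1)` of a given family of operations `ft`. -/
def ftIter {Sg : Signature (S₀ × ℕ)} (ft : ∀ n, Term Sg V (c, n + 1) → Term Sg V (c, n)) :
    ∀ n, Term Sg V (c, n + 1) → Term Sg V (c, 1)
  | 0, t => t
  | n + 1, t => ftIter ft n (ft (n + 1) t)

end BaseTerms

/-- The base theory, with axioms `⊢ *↓`, `⊢_x x = *` and `⊢_x ctx_{c,n}(x) = x`. -/
abbrev baseTheory (c : S₀) : Theory (S₀ × ℕ) where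
  sig := baseSig c
  ax :=
    {⟨Ctx.empty _, .top, baseStar.defined⟩,
      ⟨Ctx.single (c, 0), .top,
        .eq (.var (V := Ctx.single (c, 0)) (0 : Fin 1)) baseStar⟩} ∪
    Set.range fun n : ℕ =>
      ⟨Ctx.single (c, n), .top,
        .eq (baseCtx c n (.var (V := Ctx.single (c, n)) (0 : Fin 1)))
          (.var (V := Ctx.single (c, n)) (0 : Fin 1))⟩

/-- The symbols `L(σ) : (c, 1) × L(s₁) × … × L(sₖ) → L(s)` and
`L(R) : (c, 1) × L(s₁) × … × L(sₖ)`, where `L(p, n) = (p, n + 1)`. -/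
abbrev liftSig (c : S₀) (Sg : Signature (S₀ × ℕ)) : Signature (S₀ × ℕ) where
  Func := Sg.Func
  Pred := Sg.Pred
  dom σ := (Sg.dom σ).ext c 1
  cod σ := shift 1 (Sg.cod σ)
  pdom R := (Sg.pdom R).ext c 1

/-- The signature of `L(T)`: the symbols `L(σ)` and `L(R)` together with the base symbols. -/
abbrev LSig (c : S₀) (Sg : Signature (S₀ × ℕ)) : Signature (S₀ × ℕ) :=
  (liftSig c Sg).sum (baseSig c)

section LTerms

variable {c : S₀} {Sg Sg' : Signature (S₀ × ℕ)} {V W : Ctx (S₀ × ℕ)}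

/-- The base term `ftₙ(t)` in the signature of `L(T)`. -/
def lFt (n : ℕ) (t : Term (LSig c Sg) W (c, n + 1)) : Term (LSig c Sg) W (c, n) :=
  .app (Sg := LSig c Sg) (Sum.inr (BaseFunc.ft n)) (fun _ => t)

/-- The base term `ctx_{p,n}(t)` in the signature of `L(T)`. -/
def lCtx (p : S₀) (n : ℕ) (t : Term (LSig c Sg) W (p, n)) : Term (LSig c Sg) W (c, n) :=
  .app (Sg := LSig c Sg) (Sum.inr (BaseFunc.ctx p n)) (fun _ => t)

/-- The variable `Γ : (c, 1)`. -/
def varΓ : Term (LSig c Sg) (V.ext c 1) (c, 1) :=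
  .var (V := V.ext c 1) (0 : Fin (V.len + 1))

/-- The variable `xᵢ : L(sᵢ)`. -/
def varL (i : Fin V.len) : Term (LSig c Sg) (V.ext c 1) (shift 1 (V.sort i)) :=
  .var (V := V.ext c 1) i.succ

/-- For `t : L(p, n) = (p, n + 1)`, the formula `ftⁿ(ctx_{p,n+1}(t)) = Γ`. -/
def overΓ (s : S₀ × ℕ) (t : Term (LSig c Sg) (V.ext c 1) (shift 1 s)) :
    Formula (LSig c Sg) (V.ext c 1) :=
  .eq (ftIter lFt s.2 (lCtx s.1 (s.2 + 1) t)) varΓ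

/-- The term `L(σ)(Γ, t₁, …, tₖ)`. -/
def lApp (σ : Sg.Func)
    (ts : ∀ i : Fin (Sg.dom σ).len, Term (LSig c Sg) (V.ext c 1) (shift 1 ((Sg.dom σ).sort i))) :
    Term (LSig c Sg) (V.ext c 1) (shift 1 (Sg.cod σ)) :=
  .app (Sg := LSig c Sg) (Sum.inl σ)
    (Fin.cases (motive := fun x =>
      Term (LSig c Sg) (V.ext c 1) (((Sg.dom σ).ext c 1).sort x)) varΓ ts)

/-- The formula `L(R)(Γ, t₁, …, tₖ)`. -/
def lRel (R : Sg.Pred)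
    (ts : ∀ i : Fin (Sg.pdom R).len,
      Term (LSig c Sg) (V.ext c 1) (shift 1 ((Sg.pdom R).sort i))) :
    Formula (LSig c Sg) (V.ext c 1) :=
  .rel (Sg := LSig c Sg) (Sum.inl R)
    (Fin.cases (motive := fun x =>
      Term (LSig c Sg) (V.ext c 1) (((Sg.pdom R).ext c 1).sort x)) varΓ ts)

/-- The restricted term `L(Γ, t)`: a variable `x` becomes `x` restricted to
`ftⁿ(ctx_{p,n+1}(x)) = Γ`, which in `L(T)` is the domain of `L(ctx_{p,n})(Γ, x)`. -/
def lTerm (c : S₀) : ∀ {s : S₀ × ℕ}, Term Sg V s → RTerm (LSig c Sg) (V.ext c 1) (shift 1 s)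
  | _, .var x => ⟨varL x, overΓ (V.sort x) (varL x)⟩
  | _, .app σ ts =>
      ⟨lApp σ (fun i => (lTerm c (ts i)).tm), .conj fun i => (lTerm c (ts i)).cond⟩

/-- The formula `L(Γ, φ)`. -/
def lFormula (c : S₀) : Formula Sg V → Formula (LSig c Sg) (V.ext c 1)
  | .top => .top
  | .and φ ψ => .and (lFormula c φ) (lFormula c ψ)
  | .eq t t' => .and (.eq (lTerm c t).tm (lTerm c t').tm)
      (.and (lTerm c t).cond (lTerm c t').cond)
  | .rel R ts => .and (lRel R (fun i => (lTerm c (ts i)).tm))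
      (.conj fun i => (lTerm c (ts i)).cond)

/-- `L(Γ, t|_φ) = L(Γ, t)|_{L(Γ, φ)}`. -/
def lRTerm (c : S₀) {s : S₀ × ℕ} (r : RTerm Sg V s) :
    RTerm (LSig c Sg) (V.ext c 1) (shift 1 s) :=
  ⟨(lTerm c r.tm).tm, .and (lTerm c r.tm).cond (lFormula c r.cond)⟩

/-- `L(f)`, which sends `L(σ)(Γ, x₁, …, xₖ)` to `L(Γ, f(σ(x₁, …, xₖ)))`, similarly for predicate
symbols, and fixes the base symbols. -/
def LTranslation (c : S₀) (f : Translation Sg Sg') :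
    Translation (LSig c Sg) (LSig c Sg') where
  func
    | .inl σ => lRTerm c (f.func σ)
    | .inr b => (Translation.inr (liftSig c Sg') (baseSig c)).func b
  pred
    | .inl R => lFormula c (f.pred R)
    | .inr b => (Translation.inr (liftSig c Sg') (baseSig c)).pred b

end LTerms

/-- The axioms of `L(T)`, where `i` is the interpretation of the base theory in `T`. -/
inductive LAx (c : S₀) (Sg : Signature (S₀ × ℕ)) (i : Translation (baseSig c) Sg) :
    Sequent (LSig c Sg) → Prop
  /-- the axioms of the base theory -/
  | base (q : Sequent (baseSig c)) (hq : q ∈ (baseTheory c).ax) : LAx c Sg i q.inr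
  /-- `ftⁿ(ctx_{p,n+1}(x)) = Γ ⊢ ctx_{p,n+1}(x) = L(ctx_{p,n})(Γ, x)` -/
  | ctx (p : S₀) (n : ℕ) : LAx c Sg i
      ⟨(Ctx.single (p, n)).ext c 1,
        overΓ (V := Ctx.single (p, n)) (p, n) (varL (V := Ctx.single (p, n)) (0 : Fin 1)),
        .and
          (.eq (lCtx p (n + 1) (varL (V := Ctx.single (p, n)) (0 : Fin 1)))
            (lRTerm c (i.func (BaseFunc.ctx p n))).tm)
          (lRTerm c (i.func (BaseFunc.ctx p n))).cond⟩
  /-- `L(σ)(Γ, x₁, …, xₖ)↓ ⊢ ftⁿ(ctx_{p,n+1}(L(σ)(Γ, x₁, …, xₖ))) = Γ` -/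
  | func_cod (σ : Sg.Func) : LAx c Sg i
      ⟨(Sg.dom σ).ext c 1, (lApp σ varL).defined, overΓ (Sg.cod σ) (lApp σ varL)⟩
  /-- `L(σ)(Γ, x₁, …, xₖ)↓ ⊢ ftⁿⁱ(ctx_{pᵢ,nᵢ+1}(xᵢ)) = Γ` -/
  | func_dom (σ : Sg.Func) (j : Fin (Sg.dom σ).len) : LAx c Sg i
      ⟨(Sg.dom σ).ext c 1, (lApp σ varL).defined, overΓ ((Sg.dom σ).sort j) (varL j)⟩
  /-- `L(R)(Γ, x₁, …, xₖ) ⊢ ftⁿⁱ(ctx_{pᵢ,nᵢ+1}(xᵢ)) = Γ` -/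
  | pred_dom (R : Sg.Pred) (j : Fin (Sg.pdom R).len) : LAx c Sg i
      ⟨(Sg.pdom R).ext c 1, lRel R varL, overΓ ((Sg.pdom R).sort j) (varL j)⟩

/-- The theory `L(T)`, for a theory `T` under the base theory. -/
abbrev LTheory (c : S₀) (T : Theory (S₀ × ℕ)) (i : Translation (baseSig c) T.sig) :
    Theory (S₀ × ℕ) where
  sig := LSig c T.sig
  ax := {q | LAx c T.sig i q}

/-- A prestable theory: a theory `T` under the base theory with a morphism `α : L(T) → T` under
the base theory. Both morphisms are given by representing interpretations. -/
structure PrestableTheory (c : S₀) : Type (u + 1) where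
  T : Theory (S₀ × ℕ)
  i : Translation (baseSig c) T.sig
  i_int : IsInterpretation (baseTheory c) T i
  α : Translation (LSig c T.sig) T.sig
  α_int : IsInterpretation (LTheory c T i) T α
  α_under : Translation.Equiv T.ax (α.comp (Translation.inr (liftSig c T.sig) (baseSig c))) i

namespace PrestableTheory

variable {c : S₀}

/-- `f` represents a morphism of prestable theories: it is an interpretation, a morphism under
the base theory, and `f ∘ α = α ∘ L(f)` up to equivalence. Since `L(T)` does not contain the
axioms of `T` shifted by `L`, `L(f)` depends on the representing interpretation `f`, and a
morphism of prestable theories is a class that has a representative with this property. -/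
structure IsHom (A B : PrestableTheory c) (f : Translation A.T.sig B.T.sig) : Prop where
  int : IsInterpretation A.T B.T f
  under : Translation.Equiv B.T.ax (f.comp A.i) B.i
  alg : Translation.Equiv B.T.ax (f.comp A.α) (B.α.comp (LTranslation c f))

/-- `A` and `B`, with morphisms `f` and `g` from `D`, are isomorphic as prestable theories
under `D`. -/
def IsoUnder (D A B : PrestableTheory c) (f : Translation D.T.sig A.T.sig)
    (g : Translation D.T.sig B.T.sig) : Prop :=
  ∃ (e : Translation A.T.sig B.T.sig) (e' : Translation B.T.sig A.T.sig),
    IsHom A B e ∧ IsHom B A e' ∧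
    Translation.Equiv A.T.ax (e'.comp e) (Translation.id A.T.sig) ∧
    Translation.Equiv B.T.ax (e.comp e') (Translation.id B.T.sig) ∧
    Translation.Equiv B.T.ax (e.comp f) g ∧
    Translation.Equiv A.T.ax (e'.comp g) f

/-- The empty context can be extended: `⊢_Γ α(L(Γ, *))↓`. -/
def EmptyCtxExtends (A : PrestableTheory c) : Prop :=
  Derivable A.T.ax (V := (Ctx.empty _).ext c 1) .top
    (A.α.mapRTerm (lRTerm c (A.i.func BaseFunc.star))).defined

end PrestableTheory

/-! ### Contextual theories -/

/-- The symbols `σ_m : (c, m) × (p₁, n₁ + m) × … × (pₖ, nₖ + m) → (p, n + m)` and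
`R_m : (c, m) × (p₁, n₁ + m) × … × (pₖ, nₖ + m)` for all `m` and all symbols of `B`. -/
abbrev familySig (c : S₀) (B : Signature (S₀ × ℕ)) : Signature (S₀ × ℕ) where
  Func := B.Func × ℕ
  Pred := B.Pred × ℕ
  dom σ := (B.dom σ.1).ext c σ.2
  cod σ := shift σ.2 (B.cod σ.1)
  pdom R := (B.pdom R.1).ext c R.2

section Contextual

variable {c : S₀}

/-- The symbols of `Tb` together with the families of symbols indexed by `B`. -/
abbrev contextualSig (Tb : PrestableTheory c) (B : Signature (S₀ × ℕ)) : Signature (S₀ × ℕ) :=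
  Tb.T.sig.sum (familySig c B)

/-- In the variables `Γ : (c, 1), Δ : (c, m + 1), x₁, …, xₖ`, the formula `ftᵐ(Δ) = Γ`. -/
def ftEqΓ (Tb : PrestableTheory c) (B : Signature (S₀ × ℕ)) (V : Ctx (S₀ × ℕ)) (m : ℕ) :
    Formula (contextualSig Tb B) ((V.ext c m).ext c 1) :=
  (Tb.i.mapFormula (V := (V.ext c m).ext c 1)
    (.eq
      (ftIter (c := c) baseFt m
        (.var (V := (V.ext c m).ext c 1) (Fin.succ (0 : Fin (V.len + 1)))))
      (.var (V := (V.ext c m).ext c 1) (0 : Fin (V.len + 1 + 1))))).inl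

/-- In the variables `Γ : (c, 1), Δ : (c, m + 1), x₁, …, xₖ`, the tuple `Δ, x₁, …, xₖ`. -/
def dropΓ (Sg : Signature (S₀ × ℕ)) (V : Ctx (S₀ × ℕ)) (m : ℕ) :
    ∀ j : Fin (V.ext c (m + 1)).len,
      Term Sg ((V.ext c m).ext c 1) ((V.ext c (m + 1)).sort j) :=
  Fin.cases (motive := fun j =>
      Term Sg ((V.ext c m).ext c 1) ((V.ext c (m + 1)).sort j))
    (.var (V := (V.ext c m).ext c 1) (Fin.succ (0 : Fin (V.len + 1))))
    (fun j => .var (V := (V.ext c m).ext c 1) j.succ.succ)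

/-- The map `α` of a contextual theory: as in `Tb` on the symbols of `Tb`, and
`L(σ_m)(Γ, Δ, x₁, …, xₖ) ↦ σ_{m+1}(Δ, x₁, …, xₖ)|_{ftᵐ(Δ) = Γ}`,
`L(R_m)(Γ, Δ, x₁, …, xₖ) ↦ R_{m+1}(Δ, x₁, …, xₖ) ∧ ftᵐ(Δ) = Γ`. -/
def contextualα (Tb : PrestableTheory c) (B : Signature (S₀ × ℕ)) :
    Translation (LSig c (contextualSig Tb B)) (contextualSig Tb B) where
  func
    | .inl (.inl τ) => (Tb.α.func (.inl τ)).inl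
    | .inl (.inr σ) =>
        ⟨.app (Sg := contextualSig Tb B) (.inr (σ.1, σ.2 + 1)) (dropΓ _ (B.dom σ.1) σ.2),
          ftEqΓ Tb B (B.dom σ.1) σ.2⟩
    | .inr b => (Tb.α.func (.inr b)).inl
  pred
    | .inl (.inl P) => (Tb.α.pred (.inl P)).inl
    | .inl (.inr R) =>
        .and
          (.rel (Sg := contextualSig Tb B) (.inr (R.1, R.2 + 1)) (dropΓ _ (B.pdom R.1) R.2))
          (ftEqΓ Tb B (B.pdom R.1) R.2)
    | .inr b => (Tb.α.pred (.inr b)).inl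

/-- The structure map of a contextual theory under the base theory: that of `Tb`. -/
def contextualI (Tb : PrestableTheory c) (B : Signature (S₀ × ℕ)) :
    Translation (baseSig c) (contextualSig Tb B) where
  func b := (Tb.i.func b).inl
  pred b := (Tb.i.pred b).inl

/-- A contextual theory under `Tb`: basic symbols `basic`, no basic function symbol having
target sort `(c, 0)`, and a set of axioms containing those of `Tb`, such that these symbols and
axioms with the map `contextualα` form a prestable theory. -/
structure ContextualTheory (Tb : PrestableTheory c) : Type (u + 1) where
  basic : Signature (S₀ × ℕ)
  cod_ne : ∀ σ : basic.Func, basic.cod σ ≠ (c, 0)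
  ax : Set (Sequent (contextualSig Tb basic))
  ax_base : ∀ q ∈ Tb.T.ax, q.inl ∈ ax
  i_int : IsInterpretation (baseTheory c) ⟨contextualSig Tb basic, ax⟩ (contextualI Tb basic)
  α_int : IsInterpretation
    (LTheory c ⟨contextualSig Tb basic, ax⟩ (contextualI Tb basic))
    ⟨contextualSig Tb basic, ax⟩ (contextualα Tb basic)
  α_under : Translation.Equiv ax
    ((contextualα Tb basic).comp
      (Translation.inr (liftSig c (contextualSig Tb basic)) (baseSig c)))
    (contextualI Tb basic)

/-- The underlying prestable theory. -/
abbrev ContextualTheory.toPrestable {Tb : PrestableTheory c} (C : ContextualTheory Tb) :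
    PrestableTheory c where
  T := ⟨contextualSig Tb C.basic, C.ax⟩
  i := contextualI Tb C.basic
  i_int := C.i_int
  α := contextualα Tb C.basic
  α_int := C.α_int
  α_under := C.α_under

/-- The inclusion of `Tb`. -/
def ContextualTheory.incl {Tb : PrestableTheory c} (C : ContextualTheory Tb) :
    Translation Tb.T.sig C.toPrestable.T.sig :=
  Translation.inl Tb.T.sig (familySig c C.basic)

end Contextual

end Extension

end PartialHorn

/-! The sort `(c, 0)` has `*` as its only element, so a function symbol of `T` with this target
carries no information beyond its domain. The basic symbols are therefore the remaining function
symbols of `T`, its predicate symbols, and one predicate symbol for the domain of each function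
symbol with target `(c, 0)`. The symbol `σ_m` is read in `T` as `σ(x₁, …, xₖ)` with its context
extended `m` times by means of `α`; this reading is `fromContextual`. The axioms of the contextual
theory are all sequents that become theorems of `T` under it. The inverse `toContextual` sends `σ`
to `σ₀(*, x₁, …, xₖ)`, or to `*` restricted to the predicate that replaces `σ`.

The identities between translations are checked on structures. Partial Horn logic is complete
(`completeFor_models`), a translation in which all variables occur acts on structures by
`PStr.pull`, and this action turns composites into composites. Equivalence of translations and
preservation of axioms thus become statements about pulled back structures. For the contextual
theory it suffices to look at structures pulled back from models of `T` (`completeFor_pulledAx`).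

The operation `L` is handled in the same way. A structure satisfying the domain and codomain axioms
of `L(T)` amounts to a base structure together with one structure for the signature of `T` on the
elements over each `Γ`, its `slice`; and `L(f)` acts on every slice as `f` does (`slice_pull`).
Identities involving `L` are thereby reduced to identities in the slices.

Two computations remain. `pull_contextualα` matches the prescribed `α` of the contextual theory with
that of `T`. `pull_pull_contextual` shows that going to the contextual signature and back changes
nothing, provided that `*` is defined and unique. In a model of `T` this follows from the base
theory. The slices need not be models, because `L(T)` does not contain the shifted axioms of `T`;
there `*` is unique because the only element of sort `(c, 0)` over `Γ` is `Γ` itself, and it is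
defined exactly because the empty context can be extended. -/

namespace PartialHorn

/-! ### Substitution and free variables -/

section Substitution

variable {S : Type u} {Sg Sg' : Signature S} {U V W : Ctx S}

theorem Term.subst_subst (η : ∀ x : Fin U.len, Term Sg V (U.sort x))
    (θ : ∀ x : Fin V.len, Term Sg W (V.sort x)) {s : S} (t : Term Sg U s) :
    (t.subst η).subst θ = t.subst (fun x => (η x).subst θ) := by
  induction t with
  | var x => rfl
  | app σ ts ih => simp [Term.subst, ih]

theorem Formula.subst_subst (η : ∀ x : Fin U.len, Term Sg V (U.sort x))
    (θ : ∀ x : Fin V.len, Term Sg W (V.sort x)) (φ : Formula Sg U) :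
    (φ.subst η).subst θ = φ.subst (fun x => (η x).subst θ) := by
  induction φ with
  | top => rfl
  | and φ ψ ih ih' => simp [Formula.subst, ih, ih']
  | eq t t' => simp [Formula.subst, Term.subst_subst]
  | rel R ts => simp [Formula.subst, Term.subst_subst]

theorem Term.subst_var {s : S} (t : Term Sg V s) : t.subst (fun x => .var x) = t := by
  induction t with
  | var x => rfl
  | app σ ts ih => simp [Term.subst, ih]

theorem Formula.subst_var (φ : Formula Sg V) : φ.subst (fun x => .var x) = φ := by
  induction φ with
  | top => rfl
  | and φ ψ ih ih' => simp [Formula.subst, ih, ih']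
  | eq t t' => simp [Formula.subst, Term.subst_var]
  | rel R ts => simp [Formula.subst, Term.subst_var]

theorem Formula.subst_conj (θ : ∀ x : Fin V.len, Term Sg W (V.sort x)) {n : ℕ}
    (φ : Fin n → Formula Sg V) :
    (Formula.conj φ).subst θ = Formula.conj (fun i => (φ i).subst θ) := by
  induction n with
  | zero => rfl
  | succ n ih => simp [Formula.conj, Formula.subst, ih]

theorem Formula.mem_fv_conj {n : ℕ} {φ : Fin n → Formula Sg V} {i : Fin n} {x : Fin V.len}
    (h : x ∈ (φ i).fv) : x ∈ (Formula.conj φ).fv := by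
  induction n with
  | zero => exact i.elim0
  | succ n ih =>
    cases i using Fin.cases with
    | zero => exact Or.inl h
    | succ i => exact Or.inr (ih (φ := fun i => φ i.succ) h)

theorem Term.mem_fv_subst {θ : ∀ x : Fin V.len, Term Sg W (V.sort x)} {s : S} {t : Term Sg V s}
    {x : Fin V.len} {y : Fin W.len} (hx : x ∈ t.fv) (hy : y ∈ (θ x).fv) :
    y ∈ (t.subst θ).fv := by
  induction t with
  | var z =>
    obtain rfl : x = z := hx
    exact hy
  | app σ ts ih =>
    simp only [Term.fv, Term.subst, Set.mem_iUnion] at hx ⊢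
    obtain ⟨i, hi⟩ := hx
    exact ⟨i, ih i hi⟩

theorem Formula.mem_fv_subst {θ : ∀ x : Fin V.len, Term Sg W (V.sort x)} {φ : Formula Sg V}
    {x : Fin V.len} {y : Fin W.len} (hx : x ∈ φ.fv) (hy : y ∈ (θ x).fv) :
    y ∈ (φ.subst θ).fv := by
  induction φ with
  | top => exact hx
  | and φ ψ ih ih' => exact hx.imp ih ih'
  | eq t t' => exact hx.imp (Term.mem_fv_subst · hy) (Term.mem_fv_subst · hy)
  | rel R ts =>
    simp only [Formula.fv, Formula.subst, Set.mem_iUnion] at hx ⊢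
    obtain ⟨i, hi⟩ := hx
    exact ⟨i, Term.mem_fv_subst hi hy⟩

theorem Term.fv_inl {s : S} (t : Term Sg V s) : (t.inl (Sg' := Sg')).fv = t.fv := by
  induction t with
  | var x => rfl
  | app σ ts ih => exact Set.iUnion_congr ih

theorem Formula.fv_inl (φ : Formula Sg V) : (φ.inl (Sg' := Sg')).fv = φ.fv := by
  induction φ with
  | top => rfl
  | and φ ψ ih ih' => simp [Formula.fv, Formula.inl, ih, ih']
  | eq t t' => simp [Formula.fv, Formula.inl, Term.fv_inl]
  | rel R ts => exact Set.iUnion_congr fun i => Term.fv_inl _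

theorem RTerm.fv_inl {s : S} (r : RTerm Sg V s) : (r.inl (Sg' := Sg')).fv = r.fv := by
  simp [RTerm.fv, RTerm.inl, Term.fv_inl, Formula.fv_inl]

/-- All variables of a symbol occur in its translation. -/
structure Translation.Full (f : Translation Sg Sg') : Prop where
  func : ∀ σ, (f.func σ).fv = Set.univ
  pred : ∀ R, (f.pred R).fv = Set.univ

theorem IsInterpretation.full {T T' : Theory S} {f : Translation T.sig T'.sig}
    (hf : IsInterpretation T T' f) : f.Full := ⟨hf.fv_func, hf.fv_pred⟩

/-- A variable may survive only in the condition and not in the underlying term, which is why the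
free variables of both are counted. -/
theorem Translation.Full.mem_fv_mapTerm {f : Translation Sg Sg'} (hf : f.Full) {s : S}
    {t : Term Sg V s} {x : Fin V.len} (hx : x ∈ t.fv) : x ∈ (f.mapTerm t).fv := by
  induction t with
  | var z => exact Or.inl hx
  | app σ ts ih =>
    simp only [Term.fv, Set.mem_iUnion] at hx
    obtain ⟨i, hi⟩ := hx
    rcases ih i hi with h | h
    · have hi' : i ∈ (f.func σ).fv := by rw [hf.func]; trivial
      exact hi'.imp (Term.mem_fv_subst · h) fun h' => Or.inl (Formula.mem_fv_subst h' h)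
    · exact Or.inr (Or.inr (Formula.mem_fv_conj (i := i) h))

theorem Translation.Full.mem_fv_mapFormula {f : Translation Sg Sg'} (hf : f.Full)
    {φ : Formula Sg V} {x : Fin V.len} (hx : x ∈ φ.fv) : x ∈ (f.mapFormula φ).fv := by
  induction φ with
  | top => exact hx
  | and φ ψ ih ih' => exact hx.imp ih ih'
  | eq t t' =>
    rcases hx with h | h
    · exact (hf.mem_fv_mapTerm h).imp Or.inl Or.inl
    · exact (hf.mem_fv_mapTerm h).imp Or.inr Or.inr
  | rel R ts =>
    simp only [Formula.fv, Set.mem_iUnion] at hx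
    obtain ⟨i, hi⟩ := hx
    rcases hf.mem_fv_mapTerm hi with h | h
    · have hi' : i ∈ (f.pred R).fv := by rw [hf.pred]; trivial
      exact Or.inl (Formula.mem_fv_subst hi' h)
    · exact Or.inr (Formula.mem_fv_conj (i := i) h)

theorem Translation.Full.mem_fv_mapRTerm {f : Translation Sg Sg'} (hf : f.Full) {s : S}
    {r : RTerm Sg V s} {x : Fin V.len} (hx : x ∈ r.fv) : x ∈ (f.mapRTerm r).fv := by
  rcases hx with h | h
  · exact (hf.mem_fv_mapTerm h).imp (fun h => h) Or.inl
  · exact Or.inr (Or.inr (hf.mem_fv_mapFormula h))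

end Substitution

/-! ### Derived rules -/

namespace Derivable

variable {S : Type u} {Sg : Signature S} {A : Set (Sequent Sg)} {V W : Ctx S}

theorem conj_intro {n : ℕ} {χ : Formula Sg V} {φ : Fin n → Formula Sg V}
    (h : ∀ i, Derivable A χ (φ i)) : Derivable A χ (.conj φ) := by
  induction n with
  | zero => exact .top _
  | succ n ih => exact .and_intro (h 0) (ih fun i => h i.succ)

/-- A term substituted for a free variable of a formula that holds is defined. -/
theorem strict (φ : Formula Sg V) (θ : ∀ x : Fin V.len, Term Sg W (V.sort x))
    (hθ : ∀ x, x ∈ φ.fv) (x : Fin V.len) : Derivable A (φ.subst θ) (θ x).defined :=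
  .subst (ψ := Term.defined (.var x)) θ (fun x => Or.inl (hθ x)) (.cut (.top φ) (.var_defined x))

/-- An instance of strictness, for the formula `x = y` in two variables. -/
theorem eq_left {s : S} (t t' : Term Sg V s) : Derivable A (.eq t t') t.defined :=
  strict (V := ⟨2, fun _ => s⟩)
    (.eq (.var (V := ⟨2, fun _ => s⟩) (0 : Fin 2)) (.var (V := ⟨2, fun _ => s⟩) (1 : Fin 2)))
    (fun x => Fin.cases t (fun _ => t') x)
    (fun x => by
      change Fin 2 at x
      fin_cases x
      · exact Or.inl rfl
      · exact Or.inr rfl) (0 : Fin 2)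

/-- Weakening by a variable put in front. -/
def _root_.PartialHorn.Term.weaken {s s' : S} (t : Term Sg V s') : Term Sg (Ctx.cons s V) s' :=
  t.subst (fun i => .var (V := Ctx.cons s V) i.succ)

theorem _root_.PartialHorn.Term.weaken_instFirst {s s' : S} (t : Term Sg V s') (a : Term Sg V s) :
    (t.weaken (s := s)).subst (instFirst a) = t := by
  exact (Term.subst_subst _ _ t).trans t.subst_var

theorem eq_symm {s : S} {t t' : Term Sg V s} {χ : Formula Sg V} (h : Derivable A χ (.eq t t')) :
    Derivable A χ (.eq t' t) := by
  -- Replacement in the formula `x = t`, with `t` weakened so that only the left side changes.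
  have := Derivable.replace (A := A) t t'
    (.eq (.var (V := Ctx.cons s V) (0 : Fin (V.len + 1))) (t.weaken (s := s)))
  change Derivable A (.and (.eq t t') (.eq t (t.weaken.subst (instFirst t))))
    (.eq t' (t.weaken.subst (instFirst t'))) at this
  rw [Term.weaken_instFirst, Term.weaken_instFirst] at this
  exact .cut (.and_intro h (.cut h (eq_left _ _))) this

theorem eq_trans {s : S} {t t' t'' : Term Sg V s} {χ : Formula Sg V}
    (h : Derivable A χ (.eq t t')) (h' : Derivable A χ (.eq t' t'')) :
    Derivable A χ (.eq t t'') := by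
  have := Derivable.replace (A := A) t' t''
    (.eq (t.weaken (s := s)) (.var (V := Ctx.cons s V) (0 : Fin (V.len + 1))))
  change Derivable A (.and (.eq t' t'') (.eq (t.weaken.subst (instFirst t')) t'))
    (.eq (t.weaken.subst (instFirst t'')) t'') at this
  rw [Term.weaken_instFirst, Term.weaken_instFirst] at this
  exact .cut (.and_intro h' h) this

/-- Simultaneous replacement of equals by equals. -/
theorem replace_all {χ : Formula Sg V} {θ θ' : ∀ x : Fin W.len, Term Sg V (W.sort x)}
    (h : ∀ x, Derivable A χ (.eq (θ x) (θ' x))) (ψ : Formula Sg W)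
    (hψ : Derivable A χ (ψ.subst θ)) : Derivable A χ (ψ.subst θ') := by
  -- The rule `replace` treats one variable at a time; after `k` steps the first `k` entries of `θ`
  -- have been exchanged for those of `θ'`.
  have key : ∀ k, k ≤ W.len →
      Derivable A χ (ψ.subst fun x => if x.1 < k then θ' x else θ x) := by
    intro k
    induction k with
    | zero => intro _; simpa using hψ
    | succ k ih =>
      intro hk
      let j : Fin W.len := ⟨k, hk⟩
      -- The intermediate substitution with a fresh variable at the place `j`; instantiating that
      -- variable by `θ j` and by `θ' j` gives two consecutive stages.
      let η : ∀ x : Fin W.len, Term Sg (Ctx.cons (W.sort j) V) (W.sort x) := fun x =>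
        if e : j = x then e ▸ .var (V := Ctx.cons (W.sort j) V) (0 : Fin (V.len + 1))
        else (if x.1 < k then θ' x else θ x).weaken
      have hη : ∀ (a : Term Sg V (W.sort j)) x, (η x).subst (instFirst a) =
          if e : j = x then e ▸ a else if x.1 < k then θ' x else θ x := by
        intro a x
        by_cases e : j = x
        · subst e
          have e0 : η j = .var (V := Ctx.cons (W.sort j) V) (0 : Fin (V.len + 1)) := dif_pos rfl
          refine (congrArg (Term.subst (instFirst a)) e0).trans (Eq.symm ?_)
          exact dif_pos rfl
        · simp only [η, e, dite_false]
          exact Term.weaken_instFirst _ _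
      have := Derivable.replace (A := A) (θ j) (θ' j) (ψ.subst η)
      simp only [Formula.subst_subst, hη] at this
      have e1 : (fun x => if e : j = x then e ▸ θ j else if x.1 < k then θ' x else θ x)
          = fun x => if x.1 < k then θ' x else θ x := by
        funext x
        by_cases e : j = x
        · subst e; simp [j]
        · simp [e]
      have e2 : (fun x => if e : j = x then e ▸ θ' j else if x.1 < k then θ' x else θ x)
          = fun x => if x.1 < k + 1 then θ' x else θ x := by
        funext x
        by_cases e : j = x
        · subst e; simp [j]
        · have : x.1 ≠ k := fun h => e (Fin.ext h.symm)
          have : x.1 < k + 1 ↔ x.1 < k := by omega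
          simp [e, this]
      rw [e1, e2] at this
      exact .cut (.and_intro (h j) (ih (by omega))) this
  simpa using key W.len le_rfl

theorem app_congr {χ : Formula Sg V} {σ : Sg.Func}
    {ts ts' : ∀ i : Fin (Sg.dom σ).len, Term Sg V ((Sg.dom σ).sort i)}
    (h : ∀ i, Derivable A χ (.eq (ts i) (ts' i)))
    (hd : Derivable A χ (Term.app σ ts).defined) :
    Derivable A χ (.eq (.app σ ts) (.app σ ts')) := by
  -- The equation is an instance of `y = σ(x₁, …, xₖ)`, where the additional variable `y` holds the
  -- unchanged left side.
  let W := Ctx.cons (Sg.cod σ) (Sg.dom σ)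
  let ext : (∀ i : Fin (Sg.dom σ).len, Term Sg V ((Sg.dom σ).sort i)) →
      ∀ x : Fin W.len, Term Sg V (W.sort x) := fun us =>
    Fin.cases (motive := fun x => Term Sg V (W.sort x)) (.app σ ts) us
  exact replace_all (θ := ext ts) (θ' := ext ts')
    (fun x => by
      cases x using Fin.cases with
      | zero => exact hd
      | succ i => exact h i)
    (.eq (.var (V := W) (0 : Fin ((Sg.dom σ).len + 1)))
      (.app σ fun i => .var (V := W) i.succ)) hd

theorem rel_congr {χ : Formula Sg V} {R : Sg.Pred}
    {ts ts' : ∀ i : Fin (Sg.pdom R).len, Term Sg V ((Sg.pdom R).sort i)}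
    (h : ∀ i, Derivable A χ (.eq (ts i) (ts' i))) (hd : Derivable A χ (.rel R ts)) :
    Derivable A χ (.rel R ts') :=
  replace_all h (.rel R fun i => .var i) hd

theorem app_strict {χ : Formula Sg V} {σ : Sg.Func}
    {ts : ∀ i : Fin (Sg.dom σ).len, Term Sg V ((Sg.dom σ).sort i)}
    (hd : Derivable A χ (Term.app σ ts).defined) (i) : Derivable A χ (ts i).defined :=
  .cut hd (strict (Term.defined (.app σ fun i => .var i)) ts
    (fun x => Or.inl (Set.mem_iUnion.2 ⟨x, rfl⟩)) i)

theorem rel_strict {χ : Formula Sg V} {R : Sg.Pred}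
    {ts : ∀ i : Fin (Sg.pdom R).len, Term Sg V ((Sg.pdom R).sort i)}
    (hd : Derivable A χ (.rel R ts)) (i) : Derivable A χ (ts i).defined :=
  .cut hd (strict (.rel R fun i => .var i) ts (fun x => Set.mem_iUnion.2 ⟨x, rfl⟩) i)

/-- Substitution of defined terms. -/
theorem subst_defined {χ : Formula Sg V} {φ ψ : Formula Sg W}
    {θ : ∀ x : Fin W.len, Term Sg V (W.sort x)} (h : Derivable A φ ψ)
    (hθ : ∀ x, Derivable A χ (θ x).defined) (hφ : Derivable A χ (φ.subst θ)) :
    Derivable A χ (ψ.subst θ) := by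
  -- Adding `x↓` for every variable to the antecedent makes every variable free in it, so the side
  -- condition of the substitution rule holds for arbitrary terms.
  have := Derivable.subst (φ := .and φ (.conj fun x : Fin W.len => Term.defined (.var x))) θ
    (fun x => Or.inl (Or.inr (Formula.mem_fv_conj (i := x) (Or.inl rfl))))
    (.cut (.and_left _ _) h)
  refine .cut (.and_intro hφ ?_) this
  rw [Formula.subst_conj]
  exact conj_intro hθ

end Derivable

/-! ### Partial structures -/

/-- A partial structure with underlying family of sets `X`. -/
@[ext]
structure PStr {S : Type u} (Sg : Signature S) (X : S → Type u) : Type u where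
  func : ∀ σ : Sg.Func, (∀ i : Fin (Sg.dom σ).len, X ((Sg.dom σ).sort i)) → X (Sg.cod σ) → Prop
  pred : ∀ R : Sg.Pred, (∀ i : Fin (Sg.pdom R).len, X ((Sg.pdom R).sort i)) → Prop
  func_unique : ∀ σ b a a', func σ b a → func σ b a' → a = a'

/-- Values for the variables of `V`. -/
abbrev Val {S : Type u} (X : S → Type u) (V : Ctx S) : Type u := ∀ x : Fin V.len, X (V.sort x)

section Semantics

variable {S : Type u} {Sg Sg' Sg'' : Signature S} {X : S → Type u} {V W : Ctx S}

/-- `a` is the value of the term. -/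
def Term.Ev (M : PStr Sg X) (v : Val X V) : ∀ {s : S}, Term Sg V s → X s → Prop
  | _, .var x, a => a = v x
  | _, .app σ ts, a => ∃ b, (∀ i, (ts i).Ev M v (b i)) ∧ M.func σ b a

theorem Term.IsVar.ev {M : PStr Sg X} {v : Val X V} {s : S} {t : Term Sg V s} (h : t.IsVar) :
    ∃ a, t.Ev M v a := by
  cases t with
  | var y => exact ⟨_, rfl⟩
  | app σ ts => exact h.elim

/-- Satisfaction of a formula. -/
def Formula.Sat (M : PStr Sg X) (v : Val X V) : Formula Sg V → Prop
  | .top => True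
  | .and φ ψ => φ.Sat M v ∧ ψ.Sat M v
  | .eq t t' => ∃ a, t.Ev M v a ∧ t'.Ev M v a
  | .rel R ts => ∃ b, (∀ i, (ts i).Ev M v (b i)) ∧ M.pred R b

/-- `a` is the value of the restricted term. -/
def RTerm.Ev (M : PStr Sg X) (v : Val X V) {s : S} (r : RTerm Sg V s) (a : X s) : Prop :=
  r.tm.Ev M v a ∧ r.cond.Sat M v

/-- A model of a set of sequents. -/
def PStr.Models (M : PStr Sg X) (A : Set (Sequent Sg)) : Prop :=
  ∀ q ∈ A, ∀ v, q.lhs.Sat M v → q.rhs.Sat M v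

theorem Term.Ev.unique {M : PStr Sg X} {v : Val X V} {s : S} {t : Term Sg V s} {a a' : X s}
    (h : t.Ev M v a) (h' : t.Ev M v a') : a = a' := by
  induction t with
  | var x => exact h.trans h'.symm
  | app σ ts ih =>
    obtain ⟨b, hb, hm⟩ := h
    obtain ⟨b', hb', hm'⟩ := h'
    obtain rfl : b = b' := funext fun i => ih i (hb i) (hb' i)
    exact M.func_unique _ _ _ _ hm hm'

theorem Formula.sat_conj {M : PStr Sg X} {v : Val X V} {n : ℕ} {φ : Fin n → Formula Sg V} :
    (Formula.conj φ).Sat M v ↔ ∀ i, (φ i).Sat M v := by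
  induction n with
  | zero => exact ⟨fun _ i => i.elim0, fun _ => trivial⟩
  | succ n ih => exact (and_congr Iff.rfl ih).trans (Fin.forall_fin_succ (P := fun i => (φ i).Sat M v)).symm

theorem Term.sat_defined {M : PStr Sg X} {v : Val X V} {s : S} {t : Term Sg V s} :
    t.defined.Sat M v ↔ ∃ a, t.Ev M v a := by
  simp [Term.defined, Formula.Sat]

theorem RTerm.sat_defined {M : PStr Sg X} {v : Val X V} {s : S} {r : RTerm Sg V s} :
    r.defined.Sat M v ↔ ∃ a, r.Ev M v a := by
  simp [RTerm.defined, Formula.Sat, Term.sat_defined, RTerm.Ev]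

theorem Term.ev_app_vars {M : PStr Sg X} {v : Val X V} {σ : Sg.Func}
    {ts : ∀ i : Fin (Sg.dom σ).len, Term Sg V ((Sg.dom σ).sort i)} {w : Val X (Sg.dom σ)}
    (hw : ∀ i, (ts i).Ev M v (w i)) {a : X (Sg.cod σ)} :
    (Term.app σ ts).Ev M v a ↔ M.func σ w a := by
  refine ⟨fun ⟨b, hb, h⟩ => ?_, fun h => ⟨w, hw, h⟩⟩
  rwa [show w = b from funext fun i => (hw i).unique (hb i)]

theorem Formula.sat_rel_vars {M : PStr Sg X} {v : Val X V} {R : Sg.Pred}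
    {ts : ∀ i : Fin (Sg.pdom R).len, Term Sg V ((Sg.pdom R).sort i)} {w : Val X (Sg.pdom R)}
    (hw : ∀ i, (ts i).Ev M v (w i)) : (Formula.rel R ts).Sat M v ↔ M.pred R w := by
  refine ⟨fun ⟨b, hb, h⟩ => ?_, fun h => ⟨w, hw, h⟩⟩
  rwa [show w = b from funext fun i => (hw i).unique (hb i)]

section Subst

variable {M : PStr Sg X} {v : Val X W} {θ : ∀ x : Fin V.len, Term Sg W (V.sort x)}

theorem Term.ev_subst {w : Val X V} (hw : ∀ x, (θ x).Ev M v (w x)) {s : S} {t : Term Sg V s}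
    {a : X s} : (t.subst θ).Ev M v a ↔ t.Ev M w a := by
  induction t with
  | var x => exact ⟨fun h => h.unique (hw x), fun h => h ▸ hw x⟩
  | app σ ts ih =>
    exact exists_congr fun b => and_congr (forall_congr' fun i => ih i) Iff.rfl

theorem Formula.sat_subst {w : Val X V} (hw : ∀ x, (θ x).Ev M v (w x)) {φ : Formula Sg V} :
    (φ.subst θ).Sat M v ↔ φ.Sat M w := by
  induction φ with
  | top => rfl
  | and φ ψ ih ih' => exact and_congr ih ih'
  | eq t t' =>
    exact exists_congr fun a => and_congr (Term.ev_subst hw) (Term.ev_subst hw)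
  | rel R ts =>
    exact exists_congr fun b => and_congr (forall_congr' fun i => Term.ev_subst hw) Iff.rfl

theorem Term.Ev.strict {s : S} {t : Term Sg V s} {a : X s} (h : (t.subst θ).Ev M v a)
    {x : Fin V.len} (hx : x ∈ t.fv) : ∃ a, (θ x).Ev M v a := by
  induction t with
  | var y =>
    obtain rfl : x = y := hx
    exact ⟨a, h⟩
  | app σ ts ih =>
    obtain ⟨b, hb, -⟩ := h
    obtain ⟨i, hi⟩ := Set.mem_iUnion.1 hx
    exact ih i (hb i) hi

/-- The semantic counterpart of the side condition of the substitution rule: a term put in place of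
a free variable has a value as soon as the formula holds. -/
theorem Formula.Sat.strict {φ : Formula Sg V} (h : (φ.subst θ).Sat M v)
    {x : Fin V.len} (hx : x ∈ φ.fv) : ∃ a, (θ x).Ev M v a := by
  induction φ with
  | top => exact hx.elim
  | and φ ψ ih ih' => exact hx.elim (ih h.1) (ih' h.2)
  | eq t t' =>
    obtain ⟨a, h1, h2⟩ := h
    exact hx.elim h1.strict h2.strict
  | rel R ts =>
    obtain ⟨b, hb, -⟩ := h
    obtain ⟨i, hi⟩ := Set.mem_iUnion.1 hx
    exact (hb i).strict hi

end Subst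

/-- Every derivable sequent holds in every model. -/
theorem Derivable.sound {A : Set (Sequent Sg)} {φ ψ : Formula Sg V} (h : Derivable A φ ψ)
    {M : PStr Sg X} (hM : M.Models A) (v : Val X V) (hφ : φ.Sat M v) : ψ.Sat M v := by
  induction h with
  | ax h => exact hM _ h v hφ
  | refl φ => exact hφ
  | cut _ _ ih ih' => exact ih' v (ih v hφ)
  | top φ => trivial
  | and_left φ ψ => exact hφ.1
  | and_right φ ψ => exact hφ.2
  | and_intro _ _ ih ih' => exact ⟨ih v hφ, ih' v hφ⟩
  | var_defined x => exact Term.sat_defined.2 ⟨_, rfl⟩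
  | @replace V s t t' φ =>
    obtain ⟨⟨a, ha, ha'⟩, h⟩ := hφ
    have aux : ∀ {t : Term Sg V s}, t.Ev M v a → ∀ x : Fin (Ctx.cons s V).len,
        (instFirst t x).Ev M v (Fin.cases (motive := fun x => X ((Ctx.cons s V).sort x)) a v x) := by
      intro t ht x
      cases x using Fin.cases with
      | zero => exact ht
      | succ i => exact rfl
    exact (Formula.sat_subst (aux ha')).2 ((Formula.sat_subst (aux ha)).1 h)
  | @subst V W φ ψ θ hθ _ ih =>
    -- By the side condition, each substituted term has a value: either it is a variable, or it
    -- replaces a variable free in the formula assumed to hold.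
    have : ∀ x, ∃ a, (θ x).Ev M v a := by
      intro x
      rcases hθ x with h | h
      · exact hφ.strict h
      · exact h.ev
    choose w hw using this
    exact (Formula.sat_subst hw).2 (ih w ((Formula.sat_subst hw).1 hφ))

/-! ### Completeness -/

section TermModel

variable (A : Set (Sequent Sg)) (χ : Formula Sg V)

/-- Terms that are defined under the assumption `χ`, up to provable equality. -/
def termSetoid (s : S) : Setoid {t : Term Sg V s // Derivable A χ t.defined} where
  r t t' := Derivable A χ (.eq t.1 t'.1)
  iseqv := ⟨fun t => t.2, Derivable.eq_symm, Derivable.eq_trans⟩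

/-- The underlying sets of the term model. -/
abbrev TermModel (s : S) : Type u := Quotient (termSetoid A χ s)

variable {A χ}

/-- The class of a term. -/
def TermModel.mk {s : S} (t : Term Sg V s) (h : Derivable A χ t.defined) : TermModel A χ s :=
  Quotient.mk (termSetoid A χ s) ⟨t, h⟩

theorem TermModel.mk_eq {s : S} {t t' : Term Sg V s} {h : Derivable A χ t.defined}
    {h' : Derivable A χ t'.defined} :
    TermModel.mk t h = TermModel.mk t' h' ↔ Derivable A χ (.eq t t') :=
  Quotient.eq (r := termSetoid A χ s)

theorem TermModel.exists_rep {s : S} (a : TermModel A χ s) : ∃ t h, a = TermModel.mk t h := by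
  obtain ⟨⟨t, h⟩, rfl⟩ := Quotient.exists_rep a
  exact ⟨t, h, rfl⟩

variable (A χ)

/-- The term model. -/
def termModel : PStr Sg (TermModel A χ) where
  func σ b a := ∃ (ts : ∀ i, Term Sg V _) (hts : ∀ i, Derivable A χ (ts i).defined), (∀ i, b i = TermModel.mk (ts i) (hts i)) ∧
    ∃ h, a = TermModel.mk (.app σ ts) h
  pred R b := ∃ (ts : ∀ i, Term Sg V _) (hts : ∀ i, Derivable A χ (ts i).defined), (∀ i, b i = TermModel.mk (ts i) (hts i)) ∧ Derivable A χ (.rel R ts)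
  func_unique := by
    rintro σ b _ _ ⟨ts, hts, hb, h, rfl⟩ ⟨ts', hts', hb', h', rfl⟩
    exact TermModel.mk_eq.2
      (Derivable.app_congr (fun i => TermModel.mk_eq.1 ((hb i).symm.trans (hb' i))) h)

variable {A χ} {v : Val (TermModel A χ) W} {θ : ∀ x : Fin W.len, Term Sg V (W.sort x)}
  {hθ : ∀ x, Derivable A χ (θ x).defined}

/-- Evaluation in the term model is substitution of representatives. Strictness supplies the values
of the arguments, and congruence makes the choice of representatives irrelevant. -/
theorem termModel_ev (hv : ∀ x, v x = TermModel.mk (θ x) (hθ x)) {s : S} {t : Term Sg W s}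
    {a : TermModel A χ s} :
    t.Ev (termModel A χ) v a ↔ ∃ h, a = TermModel.mk (t.subst θ) h := by
  induction t with
  | var x => exact ⟨fun h => ⟨hθ x, h.trans (hv x)⟩, fun ⟨_, h⟩ => h.trans (hv x).symm⟩
  | app σ us ih =>
    constructor
    · rintro ⟨b, hb, ts, hts, hbt, h, rfl⟩
      have heq : ∀ i, Derivable A χ (.eq (ts i) ((us i).subst θ)) := by
        intro i
        obtain ⟨h', e⟩ := (ih i).1 (hb i)
        exact TermModel.mk_eq.1 ((hbt i).symm.trans e)
      have := Derivable.app_congr heq h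
      exact ⟨.cut this.eq_symm (.eq_left _ _), TermModel.mk_eq.2 this⟩
    · rintro ⟨h, rfl⟩
      exact ⟨fun i => TermModel.mk ((us i).subst θ) (h.app_strict i),
        fun i => (ih i).2 ⟨_, rfl⟩, _, _, fun _ => rfl, h, rfl⟩

theorem termModel_sat (hv : ∀ x, v x = TermModel.mk (θ x) (hθ x)) {φ : Formula Sg W} :
    φ.Sat (termModel A χ) v ↔ Derivable A χ (φ.subst θ) := by
  induction φ with
  | top => exact ⟨fun _ => .top _, fun _ => trivial⟩
  | and φ ψ ih ih' =>
    exact (and_congr ih ih').trans ⟨fun h => .and_intro h.1 h.2,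
      fun h => ⟨.cut h (.and_left _ _), .cut h (.and_right _ _)⟩⟩
  | eq t t' =>
    constructor
    · rintro ⟨a, h, h'⟩
      obtain ⟨_, rfl⟩ := (termModel_ev hv).1 h
      obtain ⟨_, e⟩ := (termModel_ev hv).1 h'
      exact TermModel.mk_eq.1 e
    · intro h
      exact ⟨TermModel.mk _ (.cut h (.eq_left _ _)), (termModel_ev hv).2 ⟨_, rfl⟩,
        (termModel_ev hv).2 ⟨.cut h.eq_symm (.eq_left _ _), TermModel.mk_eq.2 h⟩⟩
  | rel R us =>
    constructor
    · rintro ⟨b, hb, ts, hts, hbt, h⟩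
      refine Derivable.rel_congr (fun i => ?_) h
      obtain ⟨h', e⟩ := (termModel_ev hv).1 (hb i)
      exact TermModel.mk_eq.1 ((hbt i).symm.trans e)
    · intro h
      exact ⟨fun i => TermModel.mk ((us i).subst θ) (h.rel_strict i),
        fun i => (termModel_ev hv).2 ⟨_, rfl⟩, _, _, fun _ => rfl, h⟩

/-- Values of variables are classes of defined terms, and axioms may be instantiated at defined
terms. -/
theorem termModel_models : (termModel A χ).Models A := by
  intro q hq v hl
  choose θ hθ hv using fun x => TermModel.exists_rep (v x)
  exact (termModel_sat hv).2 (Derivable.subst_defined (.ax hq) hθ ((termModel_sat hv).1 hl))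

end TermModel

/-- A class `K` of structures is complete for `A` if sequents that hold in it are derivable. -/
structure CompleteFor (A : Set (Sequent Sg)) (K : ∀ X : S → Type u, PStr Sg X → Prop) :
    Prop where
  derivable : ∀ {V : Ctx S} {φ ψ : Formula Sg V},
    (∀ X M, K X M → ∀ v, φ.Sat M v → ψ.Sat M v) → Derivable A φ ψ

/-- Sequents that hold in all models are derivable. -/
theorem completeFor_models (A : Set (Sequent Sg)) : CompleteFor A fun _ M => M.Models A := by
  refine ⟨fun {V φ ψ} h => ?_⟩
  have hv : ∀ x : Fin V.len, (fun x => TermModel.mk (.var x) (.cut (.top φ) (.var_defined x)) :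
      Val (TermModel A φ) V) x = TermModel.mk (.var x) (.cut (.top φ) (.var_defined x)) :=
    fun x => rfl
  -- The term model under the assumption `φ`, at the generic point where every variable denotes its
  -- own class: truth there is derivability from `φ`.
  have := h _ (termModel A φ) termModel_models _
    ((termModel_sat hv).2 (by rw [Formula.subst_var]; exact .refl φ))
  simpa only [Formula.subst_var] using (termModel_sat hv).1 this

/-! ### Pulling back structures along translations -/

/-- The structure whose operations are the values of their translations. -/
def PStr.pull (f : Translation Sg Sg') (M : PStr Sg' X) : PStr Sg X where
  func σ b a := (f.func σ).Ev M b a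
  pred R b := (f.pred R).Sat M b
  func_unique _ _ _ _ h h' := h.1.unique h'.1

section Pull

variable {f : Translation Sg Sg'} (hf : f.Full) {M : PStr Sg' X} {v : Val X V}
include hf

/-- Fullness is essential. If the translation of `σ` omitted a variable, the translated term could
have a value although the corresponding argument has none, whereas `σ` itself is strict. -/
theorem Translation.Full.ev_mapTerm {s : S} {t : Term Sg V s} {a : X s} :
    (f.mapTerm t).Ev M v a ↔ t.Ev (M.pull f) v a := by
  induction t with
  | var x => exact and_iff_left trivial
  | app σ ts ih =>
    constructor
    · rintro ⟨h, h', h''⟩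
      have : ∀ i, ∃ a, (f.mapTerm (ts i)).tm.Ev M v a := by
        intro i
        have hi : i ∈ (f.func σ).fv := by rw [hf.func]; trivial
        exact hi.elim h.strict h'.strict
      choose b hb using this
      exact ⟨b, fun i => (ih i).1 ⟨hb i, Formula.sat_conj.1 h'' i⟩,
        (Term.ev_subst hb).1 h, (Formula.sat_subst hb).1 h'⟩
    · rintro ⟨b, hb, h, h'⟩
      have hb' := fun i => (ih i).2 (hb i)
      exact ⟨(Term.ev_subst fun i => (hb' i).1).2 h, (Formula.sat_subst fun i => (hb' i).1).2 h',
        Formula.sat_conj.2 fun i => (hb' i).2⟩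

theorem Translation.Full.sat_mapFormula {φ : Formula Sg V} :
    (f.mapFormula φ).Sat M v ↔ φ.Sat (M.pull f) v := by
  induction φ with
  | top => rfl
  | and φ ψ ih ih' => exact and_congr ih ih'
  | eq t t' =>
    constructor
    · rintro ⟨⟨a, h1, h2⟩, h3, h4⟩
      exact ⟨a, hf.ev_mapTerm.1 ⟨h1, h3⟩, hf.ev_mapTerm.1 ⟨h2, h4⟩⟩
    · rintro ⟨a, h1, h2⟩
      have h1 := hf.ev_mapTerm.2 h1
      have h2 := hf.ev_mapTerm.2 h2
      exact ⟨⟨a, h1.1, h2.1⟩, h1.2, h2.2⟩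
  | rel R ts =>
    constructor
    · rintro ⟨h', h''⟩
      have : ∀ i, ∃ a, (f.mapTerm (ts i)).tm.Ev M v a := by
        intro i
        have hi : i ∈ (f.pred R).fv := by rw [hf.pred]; trivial
        exact h'.strict hi
      choose b hb using this
      exact ⟨b, fun i => hf.ev_mapTerm.1 ⟨hb i, Formula.sat_conj.1 h'' i⟩,
        (Formula.sat_subst hb).1 h'⟩
    · rintro ⟨b, hb, h'⟩
      have hb' := fun i => hf.ev_mapTerm.2 (hb i)
      exact ⟨(Formula.sat_subst fun i => (hb' i).1).2 h', Formula.sat_conj.2 fun i => (hb' i).2⟩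

theorem Translation.Full.ev_mapRTerm {s : S} {r : RTerm Sg V s} {a : X s} :
    (f.mapRTerm r).Ev M v a ↔ r.Ev (M.pull f) v a := by
  refine Iff.trans ?_ (and_congr hf.ev_mapTerm hf.sat_mapFormula)
  exact and_assoc.symm

theorem Translation.Full.pull_comp {g : Translation Sg'' Sg} :
    M.pull (f.comp g) = (M.pull f).pull g := by
  ext σ
  · exact hf.ev_mapRTerm
  · exact hf.sat_mapFormula

end Pull

theorem PStr.pull_id (M : PStr Sg X) : M.pull (Translation.id Sg) = M := by
  ext σ b
  · exact (and_iff_left trivial).trans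
      (Term.ev_app_vars (ts := fun i => .var i) (w := b) fun i => rfl)
  · exact Formula.sat_rel_vars fun i => rfl

theorem RTerm.Equiv.ev_iff {A : Set (Sequent Sg)} {s : S} {r r' : RTerm Sg V s}
    (h : r.Equiv A r') {M : PStr Sg X} (hM : M.Models A) {v : Val X V} {a : X s} :
    r.Ev M v a ↔ r'.Ev M v a := by
  constructor
  · intro ha
    obtain ⟨⟨a', h1, h2⟩, h3⟩ := h.1.sound hM v (RTerm.sat_defined.2 ⟨a, ha⟩)
    exact ⟨ha.1.unique h1 ▸ h2, h3⟩
  · intro ha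
    obtain ⟨⟨a', h1, h2⟩, h3⟩ := h.2.sound hM v (RTerm.sat_defined.2 ⟨a, ha⟩)
    exact ⟨ha.1.unique h2 ▸ h1, h3⟩

theorem Translation.Equiv.pull_eq {A : Set (Sequent Sg')} {f g : Translation Sg Sg'}
    (h : f.Equiv A g) {M : PStr Sg' X} (hM : M.Models A) : M.pull f = M.pull g := by
  ext σ b
  · exact (h.1 σ).ev_iff hM
  · exact ⟨(h.2 σ).1.sound hM b, (h.2 σ).2.sound hM b⟩

/-- This and the two criteria below for translations and interpretations turn derivability claims
into identities or properties of structures in `K`. -/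
theorem CompleteFor.rterm_equiv {A : Set (Sequent Sg)} {K : ∀ X : S → Type u, PStr Sg X → Prop}
    (hK : CompleteFor A K) {s : S} {r r' : RTerm Sg V s}
    (h : ∀ X M, K X M → ∀ v a, r.Ev M v a ↔ r'.Ev M v a) : r.Equiv A r' := by
  constructor
  · refine hK.derivable fun X M hM v hd => ?_
    obtain ⟨a, ha⟩ := RTerm.sat_defined.1 hd
    have ha' := (h X M hM v a).1 ha
    exact ⟨⟨a, ha.1, ha'.1⟩, ha'.2⟩
  · refine hK.derivable fun X M hM v hd => ?_
    obtain ⟨a, ha'⟩ := RTerm.sat_defined.1 hd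
    have ha := (h X M hM v a).2 ha'
    exact ⟨⟨a, ha.1, ha'.1⟩, ha.2⟩

theorem CompleteFor.translation_equiv {A : Set (Sequent Sg')}
    {K : ∀ X : S → Type u, PStr Sg' X → Prop} (hK : CompleteFor A K) {f g : Translation Sg Sg'}
    (h : ∀ X M, K X M → M.pull f = M.pull g) : f.Equiv A g := by
  refine ⟨fun σ => hK.rterm_equiv fun X M hM v a => ?_, fun R => ⟨hK.derivable fun X M hM v hv => ?_,
    hK.derivable fun X M hM v hv => ?_⟩⟩
  · exact Iff.of_eq (congrFun (congrFun (congrFun (congrArg PStr.func (h X M hM)) σ) v) a)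
  · exact (Iff.of_eq (congrFun (congrFun (congrArg PStr.pred (h X M hM)) R) v)).1 hv
  · exact (Iff.of_eq (congrFun (congrFun (congrArg PStr.pred (h X M hM)) R) v)).2 hv

theorem IsInterpretation.models_pull {T T' : Theory S} {f : Translation T.sig T'.sig}
    (hf : IsInterpretation T T' f) {M : PStr T'.sig X} (hM : M.Models T'.ax) :
    (M.pull f).Models T.ax :=
  fun q hq v hl => hf.full.sat_mapFormula.1 ((hf.ax q hq).sound hM v (hf.full.sat_mapFormula.2 hl))

theorem CompleteFor.isInterpretation {T T' : Theory S}
    {K : ∀ X : S → Type u, PStr T'.sig X → Prop} (hK : CompleteFor T'.ax K)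
    {f : Translation T.sig T'.sig} (hf : f.Full) (h : ∀ X M, K X M → (M.pull f).Models T.ax) :
    IsInterpretation T T' f where
  fv_func := hf.func
  fv_pred := hf.pred
  ax q hq := hK.derivable fun X M hM v hl =>
    hf.sat_mapFormula.2 (h X M hM q hq v (hf.sat_mapFormula.1 hl))

/-! ### Structures for a union of signatures -/

/-- The restriction to the first signature. -/
def PStr.fst (M : PStr (Sg.sum Sg') X) : PStr Sg X where
  func σ b a := M.func (Sum.inl σ) b a
  pred R b := M.pred (Sum.inl R) b
  func_unique σ := M.func_unique (Sum.inl σ)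

/-- The restriction to the second signature. -/
def PStr.snd (M : PStr (Sg.sum Sg') X) : PStr Sg' X where
  func σ b a := M.func (Sum.inr σ) b a
  pred R b := M.pred (Sum.inr R) b
  func_unique σ := M.func_unique (Sum.inr σ)

theorem PStr.sum_ext {M N : PStr (Sg.sum Sg') X} (h : M.fst = N.fst) (h' : M.snd = N.snd) :
    M = N := by
  ext σ b
  · rcases σ with σ | σ
    · rename_i a
      exact Iff.of_eq (congrFun (congrFun (congrFun (congrArg PStr.func h) σ) b) a)
    · rename_i a
      exact Iff.of_eq (congrFun (congrFun (congrFun (congrArg PStr.func h') σ) b) a)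
  · rcases σ with σ | σ
    · exact Iff.of_eq (congrFun (congrFun (congrArg PStr.pred h) σ) b)
    · exact Iff.of_eq (congrFun (congrFun (congrArg PStr.pred h') σ) b)

section Restrict

variable {M : PStr (Sg.sum Sg') X} {v : Val X V}

theorem Term.ev_inl {s : S} {t : Term Sg V s} {a : X s} : t.inl.Ev M v a ↔ t.Ev M.fst v a := by
  induction t with
  | var x => rfl
  | app σ ts ih => exact exists_congr fun b => and_congr (forall_congr' fun i => ih i) Iff.rfl

theorem Formula.sat_inl {φ : Formula Sg V} : φ.inl.Sat M v ↔ φ.Sat M.fst v := by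
  induction φ with
  | top => rfl
  | and φ ψ ih ih' => exact and_congr ih ih'
  | eq t t' => exact exists_congr fun a => and_congr Term.ev_inl Term.ev_inl
  | rel R ts =>
    exact exists_congr fun b => and_congr (forall_congr' fun i => Term.ev_inl) Iff.rfl

theorem RTerm.ev_inl {s : S} {r : RTerm Sg V s} {a : X s} : r.inl.Ev M v a ↔ r.Ev M.fst v a :=
  and_congr Term.ev_inl Formula.sat_inl

theorem Term.ev_inr {s : S} {t : Term Sg' V s} {a : X s} : t.inr.Ev M v a ↔ t.Ev M.snd v a := by
  induction t with
  | var x => rfl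
  | app σ ts ih => exact exists_congr fun b => and_congr (forall_congr' fun i => ih i) Iff.rfl

theorem Formula.sat_inr {φ : Formula Sg' V} : φ.inr.Sat M v ↔ φ.Sat M.snd v := by
  induction φ with
  | top => rfl
  | and φ ψ ih ih' => exact and_congr ih ih'
  | eq t t' => exact exists_congr fun a => and_congr Term.ev_inr Term.ev_inr
  | rel R ts =>
    exact exists_congr fun b => and_congr (forall_congr' fun i => Term.ev_inr) Iff.rfl

theorem PStr.pull_inl : M.pull (Translation.inl Sg Sg') = M.fst := by
  rw [← M.fst.pull_id]
  ext σ b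
  · exact RTerm.ev_inl
  · exact Formula.sat_inl

theorem PStr.pull_inr : M.pull (Translation.inr Sg Sg') = M.snd := by
  ext σ b
  · exact (and_iff_left trivial).trans
      (Term.ev_app_vars (M := M) (σ := Sum.inr σ)
        (ts := fun i => .var i) (w := b) fun i => rfl)
  · exact Formula.sat_rel_vars (M := M) (R := Sum.inr σ) (ts := fun i => .var i) (w := b) fun i => rfl

end Restrict

end Semantics

/-! ### Tuples of values -/

section Values

variable {S : Type u} {X : S → Type u} {V : Ctx S} {s : S}

/-- The value of one more variable put in front. -/
def consVal (a : X s) (v : Val X V) : Val X (Ctx.cons s V) :=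
  Fin.cases (motive := fun x => X ((Ctx.cons s V).sort x)) a v

theorem exists_eq_consVal (w : Val X (Ctx.cons s V)) :
    ∃ (a : X s) (v : Val X V), w = consVal a v :=
  ⟨w (0 : Fin (V.len + 1)), fun i => w i.succ,
    funext fun x => by cases x using Fin.cases <;> rfl⟩

theorem eq_const_of_single (b : Val X (Ctx.single s)) : b = fun _ => b (0 : Fin 1) := by
  funext i
  obtain rfl : i = (0 : Fin 1) := Fin.eq_zero i
  rfl

end Values

/-! ### Structures for the base signature -/

section Base

variable {S₀ : Type u} {c : S₀} {X : S₀ × ℕ → Type u}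

/-- The iterate `ftⁿ` in a structure for the base signature. -/
def FtIter (B : PStr (baseSig c) X) : ∀ n, X (c, n + 1) → X (c, 1) → Prop
  | 0, a, g => a = g
  | n + 1, a, g => ∃ a', B.func (.ft (n + 1)) (fun _ => a) a' ∧ FtIter B n a' g

/-- `ftⁿ(ctx_{p,n+1}(x)) = Γ`. -/
def Over (B : PStr (baseSig c) X) (Γ : X (c, 1)) (s : S₀ × ℕ) (x : X (shift 1 s)) : Prop :=
  ∃ y, B.func (.ctx s.1 (s.2 + 1)) (fun _ => x) y ∧ FtIter B s.2 y Γ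

theorem FtIter.unique {B : PStr (baseSig c) X} {n : ℕ} {a : X (c, n + 1)} {g g' : X (c, 1)}
    (h : FtIter B n a g) (h' : FtIter B n a g') : g = g' := by
  induction n with
  | zero => exact h.symm.trans h'
  | succ n ih =>
    obtain ⟨b, hb, h⟩ := h
    obtain ⟨b', hb', h'⟩ := h'
    obtain rfl := B.func_unique _ _ _ _ hb hb'
    exact ih h h'

theorem ev_ftIter {Sg : Signature (S₀ × ℕ)} {V : Ctx (S₀ × ℕ)} {M : PStr Sg X} {v : Val X V}
    {B : PStr (baseSig c) X} {ft : ∀ n, Term Sg V (c, n + 1) → Term Sg V (c, n)}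
    (hft : ∀ n t a', (ft n t).Ev M v a' ↔ ∃ a, t.Ev M v a ∧ B.func (.ft n) (fun _ => a) a')
    {n : ℕ} {t : Term Sg V (c, n + 1)} {g : X (c, 1)} :
    (ftIter ft n t).Ev M v g ↔ ∃ a, t.Ev M v a ∧ FtIter B n a g := by
  induction n with
  | zero => exact ⟨fun h => ⟨g, h, rfl⟩, fun ⟨a, h, e⟩ => (show a = g from e) ▸ h⟩
  | succ n ih =>
    refine (ih (t := ft (n + 1) t)).trans ?_
    constructor
    · rintro ⟨a, h, h'⟩
      obtain ⟨b, h1, h2⟩ := (hft _ _ _).1 h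
      exact ⟨b, h1, a, h2, h'⟩
    · rintro ⟨b, h1, a, h2, h'⟩
      exact ⟨a, (hft _ _ _).2 ⟨b, h1, h2⟩, h'⟩

theorem ev_baseFt {V : Ctx (S₀ × ℕ)} {B : PStr (baseSig c) X} {v : Val X V} (n : ℕ)
    (t : Term (baseSig c) V (c, n + 1)) (a' : X (c, n)) :
    (baseFt n t).Ev B v a' ↔ ∃ a, t.Ev B v a ∧ B.func (.ft n) (fun _ => a) a' := by
  constructor
  · rintro ⟨b, hb, h⟩
    exact ⟨b (0 : Fin 1), hb (0 : Fin 1), eq_const_of_single b ▸ h⟩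
  · rintro ⟨a, ha, h⟩
    exact ⟨fun _ => a, fun _ => ha, h⟩

section BaseModel

variable {B : PStr (baseSig c) X} (hB : B.Models (baseTheory c).ax)
include hB

theorem exists_star : ∃ a, B.func .star (fun i => Fin.elim0 i) a := by
  obtain ⟨a, ⟨b, -, h⟩, -⟩ := hB _ (Or.inl (Or.inl rfl)) (fun i => Fin.elim0 i) trivial
  exact ⟨a, (show b = fun i => Fin.elim0 i from funext fun i => Fin.elim0 i) ▸ h⟩

theorem eq_of_length_zero (x y : X (c, 0)) : x = y := by
  -- By the axiom `x = *`, every element of this sort is a value of `*`, and `*` has at most one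
  -- value.
  have aux : ∀ x : X (c, 0), B.func .star (fun i => Fin.elim0 i) x := by
    intro x
    obtain ⟨a, h, ⟨b, -, h'⟩⟩ := hB _ (Or.inl (Or.inr rfl)) (fun _ => x) trivial
    have h : a = x := h
    subst h
    exact (show b = fun i => Fin.elim0 i from funext fun i => Fin.elim0 i) ▸ h'
  exact B.func_unique _ _ _ _ (aux x) (aux y)

theorem ctx_self (n : ℕ) (x : X (c, n)) : B.func (.ctx c n) (fun _ => x) x := by
  obtain ⟨a, ⟨b, hb, h'⟩, h⟩ := hB _ (Or.inr ⟨n, rfl⟩) (fun _ => x) trivial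
  have h : a = x := h
  subst h
  have e : b = fun _ => a := funext fun i => hb i
  exact e ▸ h'

/-- For contexts the map `ctx` in the definition of `Over` is the identity. At `n = 0` this says
that `Γ` is the only element over itself. -/
theorem over_ctx_iff {n : ℕ} {Γ : X (c, 1)} {x : X (c, n + 1)} :
    Over B Γ (c, n) x ↔ FtIter B n x Γ := by
  constructor
  · rintro ⟨y, hy, h⟩
    exact B.func_unique _ _ _ _ (ctx_self hB _ x) hy ▸ h
  · intro h
    exact ⟨x, ctx_self hB _ x, h⟩

end BaseModel

end Base

/-! ### Structures for the signature of `L(T)` and their slices -/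

section LStructures

variable {S₀ : Type u} {c : S₀} {X : S₀ × ℕ → Type u} {Sg Sg' : Signature (S₀ × ℕ)}
  {V : Ctx (S₀ × ℕ)}

/-- The domains and codomains of the symbols `L(σ)` and `L(R)` lie over `Γ`. -/
structure Closed (N : PStr (LSig c Sg) X) : Prop where
  func_cod : ∀ (σ : Sg.Func) Γ (b : ∀ j, X (shift 1 ((Sg.dom σ).sort j)))
    (a : X (shift 1 (Sg.cod σ))), N.func (.inl σ) (consVal Γ b) a → Over N.snd Γ (Sg.cod σ) a
  func_dom : ∀ (σ : Sg.Func) Γ (b : ∀ j, X (shift 1 ((Sg.dom σ).sort j)))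
    (a : X (shift 1 (Sg.cod σ))), N.func (.inl σ) (consVal Γ b) a →
    ∀ j, Over N.snd Γ ((Sg.dom σ).sort j) (b j)
  pred_dom : ∀ (R : Sg.Pred) Γ (b : ∀ j, X (shift 1 ((Sg.pdom R).sort j))),
    N.pred (.inl R) (consVal Γ b) → ∀ j, Over N.snd Γ ((Sg.pdom R).sort j) (b j)

/-- The elements over `Γ`. -/
abbrev SliceSet (B : PStr (baseSig c) X) (Γ : X (c, 1)) (s : S₀ × ℕ) : Type u :=
  {x : X (shift 1 s) // Over B Γ s x}

/-- The underlying values of a tuple of elements over `Γ`, with `Γ` put in front. -/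
def sliceVal {B : PStr (baseSig c) X} {Γ : X (c, 1)} (v : Val (SliceSet B Γ) V) :
    Val X (V.ext c 1) :=
  consVal (V := ⟨V.len, fun i => shift 1 (V.sort i)⟩) Γ (fun i => (v i).1)

/-- The operations `L(σ)(Γ, -)` and `L(R)(Γ, -)` on the elements over `Γ`. -/
def slice (B : PStr (baseSig c) X) (Γ : X (c, 1)) (N : PStr (LSig c Sg) X) :
    PStr Sg (SliceSet B Γ) where
  func σ b a := N.func (.inl σ) (sliceVal b) a.1
  pred R b := N.pred (.inl R) (sliceVal b)
  func_unique σ _ _ _ h h' := Subtype.ext (N.func_unique (.inl σ) _ _ _ h h')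

section Ev

variable {N : PStr (LSig c Sg) X} {Γ : X (c, 1)}
  {w : Val X ⟨V.len, fun i => shift 1 (V.sort i)⟩}

theorem ev_lFt {W : Ctx (S₀ × ℕ)} {v : Val X W} (n : ℕ) (t : Term (LSig c Sg) W (c, n + 1))
    (a' : X (c, n)) :
    (lFt n t).Ev N v a' ↔ ∃ a, t.Ev N v a ∧ N.snd.func (.ft n) (fun _ => a) a' := by
  constructor
  · rintro ⟨b, hb, h⟩
    exact ⟨b (0 : Fin 1), hb (0 : Fin 1), eq_const_of_single b ▸ h⟩
  · rintro ⟨a, ha, h⟩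
    exact ⟨fun _ => a, fun _ => ha, h⟩

theorem ev_lCtx {W : Ctx (S₀ × ℕ)} {v : Val X W} (p : S₀) (n : ℕ) (t : Term (LSig c Sg) W (p, n))
    (a' : X (c, n)) :
    (lCtx p n t).Ev N v a' ↔ ∃ a, t.Ev N v a ∧ N.snd.func (.ctx p n) (fun _ => a) a' := by
  constructor
  · rintro ⟨b, hb, h⟩
    exact ⟨b (0 : Fin 1), hb (0 : Fin 1), eq_const_of_single b ▸ h⟩
  · rintro ⟨a, ha, h⟩
    exact ⟨fun _ => a, fun _ => ha, h⟩

theorem sat_overΓ {s : S₀ × ℕ} {t : Term (LSig c Sg) (V.ext c 1) (shift 1 s)} :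
    (overΓ s t).Sat N (consVal Γ w) ↔ ∃ x, t.Ev N (consVal Γ w) x ∧ Over N.snd Γ s x := by
  constructor
  · rintro ⟨g, h, h'⟩
    obtain ⟨y, hy, hf⟩ := (ev_ftIter ev_lFt).1 h
    obtain ⟨x, hx, hxy⟩ := (ev_lCtx _ _ _ _).1 hy
    have h' : g = Γ := h'
    subst h'
    exact ⟨x, hx, y, hxy, hf⟩
  · rintro ⟨x, hx, y, hy, h⟩
    exact ⟨Γ, (ev_ftIter ev_lFt).2 ⟨y, (ev_lCtx _ _ _ _).2 ⟨x, hx, hy⟩, h⟩, rfl⟩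

theorem ev_lApp {σ : Sg.Func}
    {ts : ∀ i : Fin (Sg.dom σ).len,
      Term (LSig c Sg) (V.ext c 1) (shift 1 ((Sg.dom σ).sort i))} {a : X (shift 1 (Sg.cod σ))} :
    (lApp σ ts).Ev N (consVal Γ w) a ↔
      ∃ b, (∀ i, (ts i).Ev N (consVal Γ w) (b i)) ∧ N.func (.inl σ) (consVal Γ b) a := by
  constructor
  · rintro ⟨b, hb, h⟩
    obtain ⟨g, b, rfl⟩ := exists_eq_consVal b
    have hg : g = Γ := hb (0 : Fin ((Sg.dom σ).len + 1))
    subst hg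
    exact ⟨b, fun i => hb i.succ, h⟩
  · rintro ⟨b, hb, h⟩
    refine ⟨consVal Γ b, fun i => ?_, h⟩
    cases i using Fin.cases with
    | zero => exact rfl
    | succ i => exact hb i

theorem sat_lRel {R : Sg.Pred}
    {ts : ∀ i : Fin (Sg.pdom R).len,
      Term (LSig c Sg) (V.ext c 1) (shift 1 ((Sg.pdom R).sort i))} :
    (lRel R ts).Sat N (consVal Γ w) ↔
      ∃ b, (∀ i, (ts i).Ev N (consVal Γ w) (b i)) ∧ N.pred (.inl R) (consVal Γ b) := by
  constructor
  · rintro ⟨b, hb, h⟩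
    obtain ⟨g, b, rfl⟩ := exists_eq_consVal b
    have hg : g = Γ := hb (0 : Fin ((Sg.pdom R).len + 1))
    subst hg
    exact ⟨b, fun i => hb i.succ, h⟩
  · rintro ⟨b, hb, h⟩
    refine ⟨consVal Γ b, fun i => ?_, h⟩
    cases i using Fin.cases with
    | zero => exact rfl
    | succ i => exact hb i

section Over

variable (hN : Closed N)
include hN

/-- For a variable this is the restriction built into `L(Γ, x)`; for a compound term it is the
codomain axiom. -/
theorem Closed.over_of_ev {s : S₀ × ℕ} {t : Term Sg V s} {a : X (shift 1 s)}
    (h : (lTerm c t).Ev N (consVal Γ w) a) : Over N.snd Γ s a := by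
  cases t with
  | var x =>
    obtain ⟨b, hb, ho⟩ := sat_overΓ.1 h.2
    exact h.1.unique hb ▸ ho
  | app σ ts =>
    obtain ⟨b, -, hb⟩ := ev_lApp.1 h.1
    exact hN.func_cod _ _ _ _ hb

theorem Closed.over_var_of_ev {s : S₀ × ℕ} {t : Term Sg V s} {a : X (shift 1 s)}
    (h : (lTerm c t).Ev N (consVal Γ w) a) {x : Fin V.len} (hx : x ∈ t.fv) :
    Over N.snd Γ (V.sort x) (w x) := by
  induction t with
  | var y =>
    obtain rfl : x = y := hx
    have ha : a = w x := h.1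
    exact ha ▸ hN.over_of_ev h
  | app σ ts ih =>
    obtain ⟨b, hb, -⟩ := ev_lApp.1 h.1
    obtain ⟨i, hi⟩ := Set.mem_iUnion.1 hx
    exact ih i ⟨hb i, Formula.sat_conj.1 h.2 i⟩ hi

theorem Closed.over_var_of_sat {φ : Formula Sg V}
    (h : (lFormula c φ).Sat N (consVal Γ w)) {x : Fin V.len} (hx : x ∈ φ.fv) :
    Over N.snd Γ (V.sort x) (w x) := by
  induction φ with
  | top => exact hx.elim
  | and φ ψ ih ih' => exact hx.elim (ih h.1) (ih' h.2)
  | eq t t' =>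
    obtain ⟨⟨a, h1, h2⟩, h3, h4⟩ := h
    exact hx.elim (hN.over_var_of_ev ⟨h1, h3⟩) (hN.over_var_of_ev ⟨h2, h4⟩)
  | rel R ts =>
    obtain ⟨b, hb, -⟩ := sat_lRel.1 h.1
    obtain ⟨i, hi⟩ := Set.mem_iUnion.1 hx
    exact hN.over_var_of_ev ⟨hb i, Formula.sat_conj.1 h.2 i⟩ hi

theorem Closed.over_var_of_rterm_ev {s : S₀ × ℕ} {r : RTerm Sg V s} {a : X (shift 1 s)}
    (h : (lRTerm c r).Ev N (consVal Γ w) a) {x : Fin V.len} (hx : x ∈ r.fv) :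
    Over N.snd Γ (V.sort x) (w x) :=
  hx.elim (hN.over_var_of_ev ⟨h.1, h.2.1⟩) (hN.over_var_of_sat h.2.2)

theorem Closed.over_of_rterm_ev {s : S₀ × ℕ} {r : RTerm Sg V s} {a : X (shift 1 s)}
    (h : (lRTerm c r).Ev N (consVal Γ w) a) : Over N.snd Γ s a :=
  hN.over_of_ev ⟨h.1, h.2.1⟩

variable {B : PStr (baseSig c) X} (hB : N.snd = B) {v : Val (SliceSet B Γ) V}
include hB

/-- Evaluating `L(Γ, t)` amounts to evaluating `t` in the slice over `Γ`, since all intermediate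
values lie over `Γ`. The base structure `B` is kept separate from `N`, so that slices of different
structures with equal base part have the same underlying sets and can be compared. -/
theorem Closed.ev_lTerm {s : S₀ × ℕ} {t : Term Sg V s} {a : X (shift 1 s)} :
    (lTerm c t).Ev N (sliceVal v) a ↔ ∃ h, t.Ev (slice B Γ N) v ⟨a, h⟩ := by
  subst hB
  induction t with
  | var x =>
    constructor
    · intro h
      exact ⟨hN.over_of_ev h, Subtype.ext h.1⟩
    · rintro ⟨h, e⟩
      have e : a = (v x).1 := congrArg Subtype.val (show ⟨a, h⟩ = v x from e)
      subst e
      exact ⟨rfl, sat_overΓ.2 ⟨_, rfl, h⟩⟩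
  | app σ ts ih =>
    constructor
    · intro h
      have ho := hN.over_of_ev h
      obtain ⟨b, hb, hf⟩ := ev_lApp.1 h.1
      have hb' : ∀ i, ∃ h, (ts i).Ev (slice N.snd Γ N) v ⟨b i, h⟩ :=
        fun i => (ih i).1 ⟨hb i, Formula.sat_conj.1 h.2 i⟩
      choose h1 h2 using hb'
      exact ⟨ho, fun i => ⟨b i, h1 i⟩, h2, hf⟩
    · rintro ⟨h, b, hb, hf⟩
      have hb' := fun i => (ih i).2 ⟨(b i).2, hb i⟩
      exact ⟨ev_lApp.2 ⟨fun i => (b i).1, fun i => (hb' i).1, hf⟩,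
        Formula.sat_conj.2 fun i => (hb' i).2⟩

theorem Closed.sat_lFormula {φ : Formula Sg V} :
    (lFormula c φ).Sat N (sliceVal v) ↔ φ.Sat (slice B Γ N) v := by
  induction φ with
  | top => rfl
  | and φ ψ ih ih' => exact and_congr ih ih'
  | eq t t' =>
    constructor
    · rintro ⟨⟨a, h1, h2⟩, h3, h4⟩
      obtain ⟨h, e⟩ := (hN.ev_lTerm hB).1 ⟨h1, h3⟩
      obtain ⟨h', e'⟩ := (hN.ev_lTerm hB).1 ⟨h2, h4⟩
      exact ⟨⟨a, h⟩, e, e'⟩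
    · rintro ⟨a, h1, h2⟩
      have h1 := (hN.ev_lTerm hB).2 ⟨a.2, h1⟩
      have h2 := (hN.ev_lTerm hB).2 ⟨a.2, h2⟩
      exact ⟨⟨a.1, h1.1, h2.1⟩, h1.2, h2.2⟩
  | rel R ts =>
    constructor
    · intro h
      obtain ⟨b, hb, hf⟩ := sat_lRel.1 h.1
      have hb' : ∀ i, ∃ h, (ts i).Ev (slice B Γ N) v ⟨b i, h⟩ :=
        fun i => (hN.ev_lTerm hB).1 ⟨hb i, Formula.sat_conj.1 h.2 i⟩
      choose h1 h2 using hb'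
      exact ⟨fun i => ⟨b i, h1 i⟩, h2, hf⟩
    · rintro ⟨b, hb, hf⟩
      have hb' := fun i => (hN.ev_lTerm hB).2 ⟨(b i).2, hb i⟩
      exact ⟨sat_lRel.2 ⟨fun i => (b i).1, fun i => (hb' i).1, hf⟩,
        Formula.sat_conj.2 fun i => (hb' i).2⟩

theorem Closed.ev_lRTerm {s : S₀ × ℕ} {r : RTerm Sg V s} {a : X (shift 1 s)} :
    (lRTerm c r).Ev N (sliceVal v) a ↔ ∃ h, r.Ev (slice B Γ N) v ⟨a, h⟩ := by
  constructor
  · intro h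
    obtain ⟨ho, h1⟩ := (hN.ev_lTerm hB).1 ⟨h.1, h.2.1⟩
    exact ⟨ho, h1, (hN.sat_lFormula hB).1 h.2.2⟩
  · rintro ⟨ho, h1, h2⟩
    have h1 := (hN.ev_lTerm hB).2 ⟨ho, h1⟩
    exact ⟨h1.1, h1.2, (hN.sat_lFormula hB).2 h2⟩

end Over

end Ev

/-! ### The functor `L` on structures -/

theorem snd_pull_LTranslation {f : Translation Sg Sg'} {N : PStr (LSig c Sg') X} :
    (N.pull (LTranslation c f)).snd = N.snd := by
  refine Eq.trans ?_ (PStr.pull_inr (M := N))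
  rfl

/-- The key property of `L(f)`: over each `Γ` it acts as `f`. Fullness of `f` is not needed here,
because the arguments already lie over `Γ`. -/
theorem slice_pull {f : Translation Sg Sg'} {N : PStr (LSig c Sg') X} (hN : Closed N)
    {B : PStr (baseSig c) X} (hB : N.snd = B) {Γ : X (c, 1)} :
    slice B Γ (N.pull (LTranslation c f)) = (slice B Γ N).pull f := by
  ext σ b
  · rename_i a
    exact (hN.ev_lRTerm hB).trans ⟨fun ⟨_, h⟩ => h, fun h => ⟨a.2, h⟩⟩
  · exact hN.sat_lFormula hB

theorem Closed.pull {f : Translation Sg Sg'} (hf : f.Full) {N : PStr (LSig c Sg') X}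
    (hN : Closed N) : Closed (N.pull (LTranslation c f)) where
  func_cod σ Γ b a h := by
    rw [snd_pull_LTranslation]
    exact hN.over_of_rterm_ev h
  func_dom σ Γ b a h j := by
    rw [snd_pull_LTranslation]
    exact hN.over_var_of_rterm_ev h (by rw [hf.func]; trivial)
  pred_dom R Γ b h j := by
    rw [snd_pull_LTranslation]
    exact hN.over_var_of_sat h (by rw [hf.pred]; trivial)

/-- Operations of a closed structure hold only for arguments and values over `Γ`, so the slices see
all of them. -/
theorem Closed.ext {N N' : PStr (LSig c Sg) X} (hN : Closed N) (hN' : Closed N')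
    (hs : N.snd = N'.snd) (h : ∀ Γ, slice N.snd Γ N = slice N.snd Γ N') : N = N' := by
  refine PStr.sum_ext ?_ hs
  ext σ b
  · rename_i a
    obtain ⟨Γ, b, rfl⟩ := exists_eq_consVal b
    have key : ∀ (hb : ∀ j, Over N.snd Γ ((Sg.dom σ).sort j) (b j))
        (ha : Over N.snd Γ (Sg.cod σ) a),
        (N.func (.inl σ) (consVal Γ b) a ↔ N'.func (.inl σ) (consVal Γ b) a) := fun hb ha =>
      Iff.of_eq (congrFun (congrFun (congrFun (congrArg PStr.func (h Γ)) σ)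
        (fun j => ⟨b j, hb j⟩)) ⟨a, ha⟩)
    constructor
    · intro hh
      exact (key (hN.func_dom _ _ _ _ hh) (hN.func_cod _ _ _ _ hh)).1 hh
    · intro hh
      exact (key (hs ▸ hN'.func_dom _ _ _ _ hh) (hs ▸ hN'.func_cod _ _ _ _ hh)).2 hh
  · obtain ⟨Γ, b, rfl⟩ := exists_eq_consVal b
    have key : ∀ (hb : ∀ j, Over N.snd Γ ((Sg.pdom σ).sort j) (b j)),
        (N.pred (.inl σ) (consVal Γ b) ↔ N'.pred (.inl σ) (consVal Γ b)) := fun hb =>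
      Iff.of_eq (congrFun (congrFun (congrArg PStr.pred (h Γ)) σ) (fun j => ⟨b j, hb j⟩))
    constructor
    · intro hh
      exact (key (hN.pred_dom _ _ _ hh)).1 hh
    · intro hh
      exact (key (hs ▸ hN'.pred_dom _ _ _ hh)).2 hh

/-- The operations `L(ctx_{p,n})(Γ, -)` extend the operations `ctx_{p,n+1}`. -/
def CtxCompat (i : Translation (baseSig c) Sg) (B : PStr (baseSig c) X)
    (N : PStr (LSig c Sg) X) : Prop :=
  ∀ p n Γ (x : SliceSet B Γ (p, n)), ∃ y : SliceSet B Γ (c, n),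
    B.func (.ctx p (n + 1)) (fun _ => x.1) y.1 ∧
    (i.func (.ctx p n)).Ev (slice B Γ N) (fun _ => x) y

/-- The axioms of `T` do not enter: nothing forces a slice to be a model of `T`. -/
theorem models_LAx_iff {i : Translation (baseSig c) Sg} {N : PStr (LSig c Sg) X} :
    N.Models {q | LAx c Sg i q} ↔
      N.snd.Models (baseTheory c).ax ∧ Closed N ∧ CtxCompat i N.snd N := by
  constructor
  · intro hN
    have hv : ∀ {σ : Sg.Func} {Γ : X (c, 1)} {b : ∀ j, X (shift 1 ((Sg.dom σ).sort j))}
        {a : X (shift 1 (Sg.cod σ))}, N.func (.inl σ) (consVal Γ b) a →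
        (lApp σ varL).Ev N (consVal Γ b) a :=
      fun h => ev_lApp.2 ⟨_, fun _ => rfl, h⟩
    have hcl : Closed N := by
      refine ⟨fun σ Γ b a h => ?_, fun σ Γ b a h j => ?_, fun R Γ b h j => ?_⟩
      · obtain ⟨a', ha', ho⟩ := (sat_overΓ (V := Sg.dom σ) (t := lApp σ varL)).1
          (hN _ (.func_cod σ) (consVal Γ b) (Term.sat_defined.2 ⟨a, hv h⟩))
        exact ha'.unique (hv h) ▸ ho
      · obtain ⟨a', ha', ho⟩ := (sat_overΓ (V := Sg.dom σ) (t := varL j)).1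
          (hN _ (.func_dom σ j) (consVal Γ b) (Term.sat_defined.2 ⟨a, hv h⟩))
        have ha' : a' = b j := ha'
        exact ha' ▸ ho
      · have hr : (lRel R varL).Sat N (consVal Γ b) := sat_lRel.2 ⟨b, fun _ => rfl, h⟩
        obtain ⟨a', ha', ho⟩ := (sat_overΓ (V := Sg.pdom R) (t := varL j)).1
          (hN _ (.pred_dom R j) (consVal Γ b) hr)
        have ha' : a' = b j := ha'
        exact ha' ▸ ho
    refine ⟨fun q hq v hl => ?_, hcl, fun p n Γ x => ?_⟩
    · exact Formula.sat_inr.1 (hN _ (.base q hq) v (Formula.sat_inr.2 hl))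
    · obtain ⟨⟨y, h1, h2⟩, h3⟩ := hN _ (.ctx p n)
        (sliceVal (V := Ctx.single (p, n)) fun _ => x) (sat_overΓ.2 ⟨_, rfl, x.2⟩)
      obtain ⟨x', hx', hy⟩ := (ev_lCtx _ _ _ _).1 h1
      have hx' : x' = x.1 := hx'
      subst hx'
      obtain ⟨ho, h⟩ := (hcl.ev_lRTerm rfl).1 ⟨h2, h3⟩
      exact ⟨⟨y, ho⟩, hy, h⟩
  · rintro ⟨hB, hcl, hctx⟩ q hq v hl
    cases hq with
    | base q hq => exact Formula.sat_inr.2 (hB q hq v (Formula.sat_inr.1 hl))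
    | ctx p n =>
      obtain ⟨Γ, b, rfl⟩ := exists_eq_consVal v
      obtain ⟨x, hx, ho⟩ := sat_overΓ.1 hl
      have hx : x = b (0 : Fin 1) := hx
      subst hx
      obtain ⟨y, hy, h⟩ := hctx p n Γ ⟨b (0 : Fin 1), ho⟩
      have h := (hcl.ev_lRTerm rfl).2 ⟨y.2, h⟩
      have e : sliceVal (V := Ctx.single (p, n))
          (fun _ => (⟨b (0 : Fin 1), ho⟩ : SliceSet N.snd Γ (p, n))) = consVal Γ b :=
        congrArg (consVal Γ) (funext fun i => by
          obtain rfl : i = (0 : Fin 1) := Fin.eq_zero i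
          rfl)
      exact ⟨⟨y.1, (ev_lCtx _ _ _ _).2 ⟨_, rfl, hy⟩, e ▸ h.1⟩, e ▸ h.2⟩
    | func_cod σ =>
      obtain ⟨Γ, b, rfl⟩ := exists_eq_consVal v
      obtain ⟨a, ha⟩ := Term.sat_defined.1 hl
      refine sat_overΓ.2 ⟨a, ha, ?_⟩
      obtain ⟨b', -, h⟩ := ev_lApp.1 ha
      exact hcl.func_cod _ _ _ _ h
    | func_dom σ j =>
      obtain ⟨Γ, b, rfl⟩ := exists_eq_consVal v
      obtain ⟨a, ha⟩ := Term.sat_defined.1 hl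
      obtain ⟨b', hb, h⟩ := ev_lApp.1 ha
      have hb : b' j = b j := hb j
      exact sat_overΓ.2 ⟨b j, rfl, hb ▸ hcl.func_dom _ _ _ _ h j⟩
    | pred_dom R j =>
      obtain ⟨Γ, b, rfl⟩ := exists_eq_consVal v
      obtain ⟨b', hb, h⟩ := sat_lRel.1 hl
      have hb : b' j = b j := hb j
      exact sat_overΓ.2 ⟨b j, rfl, hb ▸ hcl.pred_dom _ _ _ h j⟩

end LStructures

/-! ### Models of a prestable theory as structures for `L(T)` -/

namespace PrestableTheory

variable {S₀ : Type u} {c : S₀} {X : S₀ × ℕ → Type u} (A : PrestableTheory c)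
  {M : PStr A.T.sig X} (hM : M.Models A.T.ax)
include hM

theorem models_base : (M.pull A.i).Models (baseTheory c).ax := A.i_int.models_pull hM

theorem models_L : (M.pull A.α).Models {q | LAx c A.T.sig A.i q} := A.α_int.models_pull hM

theorem closed : Closed (M.pull A.α) := (models_LAx_iff.1 (A.models_L hM)).2.1

/-- The semantic form of `α` being a morphism under the base theory. -/
theorem snd_pull_α : (M.pull A.α).snd = M.pull A.i := by
  rw [← A.α_under.pull_eq hM, A.α_int.full.pull_comp, PStr.pull_inr]

theorem ctxCompat : CtxCompat A.i (M.pull A.i) (M.pull A.α) := by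
  rw [← A.snd_pull_α hM]
  exact (models_LAx_iff.1 (A.models_L hM)).2.2

end PrestableTheory

variable {S₀ : Type u} {c : S₀}

theorem Term.ev_cast {S : Type u} {Sg : Signature S} {X : S → Type u} {V : Ctx S} {M : PStr Sg X}
    {v : Val X V} {s s' : S} (h : s = s') {t : Term Sg V s'} {a : X s} :
    Term.Ev M v (h ▸ t : Term Sg V s) a ↔ t.Ev M v (h ▸ a) := by
  subst h
  rfl

/-! ### Free variables of `L(Γ, t)` -/

section Free

variable {Sg : Signature (S₀ × ℕ)} {V : Ctx (S₀ × ℕ)}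

theorem mem_fv_lTerm {s : S₀ × ℕ} {t : Term Sg V s} {x : Fin V.len} (hx : x ∈ t.fv) :
    x.succ ∈ (lTerm c t).tm.fv := by
  induction t with
  | var y =>
    obtain rfl : x = y := hx
    exact rfl
  | app σ ts ih =>
    obtain ⟨i, hi⟩ := Set.mem_iUnion.1 hx
    exact Set.mem_iUnion.2 ⟨i.succ, ih i hi⟩

theorem mem_fv_lFormula {φ : Formula Sg V} {x : Fin V.len} (hx : x ∈ φ.fv) :
    x.succ ∈ (lFormula c φ).fv := by
  induction φ with
  | top => exact hx.elim
  | and φ ψ ih ih' => exact hx.imp ih ih'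
  | eq t t' => exact Or.inl (hx.imp mem_fv_lTerm mem_fv_lTerm)
  | rel R ts =>
    obtain ⟨i, hi⟩ := Set.mem_iUnion.1 hx
    exact Or.inl (Set.mem_iUnion.2 ⟨i.succ, mem_fv_lTerm hi⟩)

theorem mem_fv_lRTerm {s : S₀ × ℕ} {r : RTerm Sg V s} {x : Fin V.len} (hx : x ∈ r.fv) :
    x.succ ∈ (lRTerm c r).fv :=
  hx.imp mem_fv_lTerm fun h => Or.inr (mem_fv_lFormula h)

end Free

/-! ### Extension of the context of an operation by means of `α` -/

section Extend

variable (A : PrestableTheory c) {X : S₀ × ℕ → Type u} {V : Ctx (S₀ × ℕ)} {m : ℕ} {s : S₀ × ℕ}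

/-- The restricted term `ftᵐ(Δ)`. -/
def ftTerm (V : Ctx (S₀ × ℕ)) (m : ℕ) : RTerm A.T.sig (V.ext c (m + 1)) (c, 1) :=
  A.i.mapTerm (ftIter (c := c) baseFt m (.var (V := V.ext c (m + 1)) (0 : Fin (V.len + 1))))

/-- The terms `ftᵐ(Δ), Δ, x₁, …, xₖ`. -/
def putFt (V : Ctx (S₀ × ℕ)) (m : ℕ) : ∀ j : Fin ((V.ext c m).ext c 1).len,
    Term A.T.sig (V.ext c (m + 1)) (((V.ext c m).ext c 1).sort j) :=
  Fin.cases (motive := fun j => Term A.T.sig (V.ext c (m + 1)) (((V.ext c m).ext c 1).sort j))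
    (ftTerm A V m).tm
    (Fin.cases (motive := fun j => Term A.T.sig (V.ext c (m + 1)) (shift 1 ((V.ext c m).sort j)))
      (.var (V := V.ext c (m + 1)) (0 : Fin (V.len + 1)))
      (fun j => .var (V := V.ext c (m + 1)) j.succ))

/-- The restricted term `α(L(ftᵐ(Δ), r(Δ, x₁, …, xₖ)))`. -/
def extendRTerm (r : RTerm A.T.sig (V.ext c m) s) :
    RTerm A.T.sig (V.ext c (m + 1)) (shift 1 s) where
  tm := (A.α.mapRTerm (lRTerm c r)).tm.subst (putFt A V m)
  cond := .and ((A.α.mapRTerm (lRTerm c r)).cond.subst (putFt A V m)) (ftTerm A V m).defined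

/-- The formula `α(L(ftᵐ(Δ), φ(Δ, x₁, …, xₖ)))`. -/
def extendFormula (φ : Formula A.T.sig (V.ext c m)) : Formula A.T.sig (V.ext c (m + 1)) :=
  .and ((A.α.mapFormula (lFormula c φ)).subst (putFt A V m)) (ftTerm A V m).defined

/-- The extension of a restricted term to contexts of all lengths. -/
def iterRTerm (r : RTerm A.T.sig (V.ext c 0) (shift 0 s)) :
    ∀ m, RTerm A.T.sig (V.ext c m) (shift m s)
  | 0 => r
  | m + 1 => extendRTerm A (iterRTerm r m)

/-- The extension of a formula to contexts of all lengths. -/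
def iterFormula (φ : Formula A.T.sig (V.ext c 0)) : ∀ m, Formula A.T.sig (V.ext c m)
  | 0 => φ
  | m + 1 => extendFormula A (iterFormula φ m)

theorem mem_fv_putFt (V : Ctx (S₀ × ℕ)) (m : ℕ) (x : Fin (V.len + 1)) : x ∈ (putFt A V m x.succ).fv := by
  cases x using Fin.cases <;> exact rfl

theorem fv_iterRTerm {r : RTerm A.T.sig (V.ext c 0) (shift 0 s)} (hr : r.fv = Set.univ) (m : ℕ) :
    (iterRTerm A r m).fv = Set.univ := by
  induction m with
  | zero => exact hr
  | succ m ih =>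
    refine Set.eq_univ_of_forall fun x => ?_
    have hx : (x : Fin (V.len + 1)) ∈ (iterRTerm A r m).fv := by rw [ih]; trivial
    exact (A.α_int.full.mem_fv_mapRTerm (mem_fv_lRTerm (c := c) hx)).imp
      (Term.mem_fv_subst · (mem_fv_putFt A V m x))
      fun h => Or.inl (Formula.mem_fv_subst h (mem_fv_putFt A V m x))

theorem fv_iterFormula {φ : Formula A.T.sig (V.ext c 0)} (hφ : φ.fv = Set.univ) (m : ℕ) :
    (iterFormula A φ m).fv = Set.univ := by
  induction m with
  | zero => exact hφ
  | succ m ih =>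
    refine Set.eq_univ_of_forall fun x => ?_
    have hx : (x : Fin (V.len + 1)) ∈ (iterFormula A φ m).fv := by rw [ih]; trivial
    exact Or.inl (Formula.mem_fv_subst
      (A.α_int.full.mem_fv_mapFormula (mem_fv_lFormula (c := c) hx)) (mem_fv_putFt A V m x))

/-- The values `Δ, x₁, …, xₖ`. -/
abbrev extVal (Δ : X (c, m)) (x : Val X ⟨V.len, fun i => shift m (V.sort i)⟩) :
    Val X (V.ext c m) :=
  consVal Δ x

/-- The values `Δ, x₁, …, xₖ` for the variables of `V.ext c m`, shifted. -/
def shiftVal (Δ : X (c, m + 1)) (x : Val X ⟨V.len, fun i => shift (m + 1) (V.sort i)⟩) :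
    Val X ⟨(V.ext c m).len, fun j => shift 1 ((V.ext c m).sort j)⟩ :=
  Fin.cases (motive := fun j => X (shift 1 ((V.ext c m).sort j))) Δ x

theorem exists_eq_shiftVal (w : Val X ⟨(V.ext c m).len, fun j => shift 1 ((V.ext c m).sort j)⟩) :
    ∃ (Δ : X (c, m + 1)) (x : Val X ⟨V.len, fun i => shift (m + 1) (V.sort i)⟩),
      w = shiftVal Δ x :=
  ⟨w (0 : Fin (V.len + 1)), fun i => w i.succ,
    funext fun x => by cases x using Fin.cases <;> rfl⟩

variable {M : PStr A.T.sig X} {Δ : X (c, m + 1)}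
  {x : Val X ⟨V.len, fun i => shift (m + 1) (V.sort i)⟩}

theorem ev_ftTerm {γ : X (c, 1)} :
    (ftTerm A V m).Ev M (extVal Δ x) γ ↔ FtIter (M.pull A.i) m Δ γ := by
  refine (A.i_int.full.ev_mapTerm.trans (ev_ftIter ev_baseFt)).trans ?_
  exact ⟨fun ⟨a, h, h'⟩ => (show a = Δ from h) ▸ h', fun h => ⟨Δ, rfl, h⟩⟩

theorem ev_putFt {γ : X (c, 1)} (h : (ftTerm A V m).Ev M (extVal Δ x) γ)
    (j : Fin ((V.ext c m).ext c 1).len) :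
    (putFt A V m j).Ev M (extVal Δ x)
      ((consVal γ (shiftVal Δ x) : Val X ((V.ext c m).ext c 1)) j) := by
  cases j using Fin.cases with
  | zero => exact h.1
  | succ j => cases j using Fin.cases <;> exact rfl

/-- The condition that `ftᵐ(Δ)` is defined guarantees a value to substitute for `Γ`. -/
theorem ev_extendRTerm {r : RTerm A.T.sig (V.ext c m) s} {a : X (shift 1 s)} :
    (extendRTerm A r).Ev M (extVal Δ x) a ↔ ∃ γ, FtIter (M.pull A.i) m Δ γ ∧
      (lRTerm c r).Ev (M.pull A.α) (consVal γ (shiftVal Δ x)) a := by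
  constructor
  · rintro ⟨h1, h2, h3⟩
    obtain ⟨γ, hγ⟩ := RTerm.sat_defined.1 h3
    exact ⟨γ, (ev_ftTerm A).1 hγ, A.α_int.full.ev_mapRTerm.1
      ⟨(Term.ev_subst (ev_putFt A hγ)).1 h1, (Formula.sat_subst (ev_putFt A hγ)).1 h2⟩⟩
  · rintro ⟨γ, hγ, h⟩
    have hγ := (ev_ftTerm A (V := V) (x := x)).2 hγ
    have h := A.α_int.full.ev_mapRTerm.2 h
    exact ⟨(Term.ev_subst (ev_putFt A hγ)).2 h.1, (Formula.sat_subst (ev_putFt A hγ)).2 h.2,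
      RTerm.sat_defined.2 ⟨γ, hγ⟩⟩

theorem sat_extendFormula {φ : Formula A.T.sig (V.ext c m)} :
    (extendFormula A φ).Sat M (extVal Δ x) ↔ ∃ γ, FtIter (M.pull A.i) m Δ γ ∧
      (lFormula c φ).Sat (M.pull A.α) (consVal γ (shiftVal Δ x)) := by
  constructor
  · rintro ⟨h2, h3⟩
    obtain ⟨γ, hγ⟩ := RTerm.sat_defined.1 h3
    exact ⟨γ, (ev_ftTerm A).1 hγ, A.α_int.full.sat_mapFormula.1
      ((Formula.sat_subst (ev_putFt A hγ)).1 h2)⟩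
  · rintro ⟨γ, hγ, h⟩
    have hγ := (ev_ftTerm A (V := V) (x := x)).2 hγ
    have h := A.α_int.full.sat_mapFormula.2 h
    exact ⟨(Formula.sat_subst (ev_putFt A hγ)).2 h, RTerm.sat_defined.2 ⟨γ, hγ⟩⟩

theorem ftIter_of_over (hM : M.Models A.T.ax) {Γ : X (c, 1)}
    (h : Over (M.pull A.α).snd Γ (c, m) Δ) : FtIter (M.pull A.i) m Δ Γ := by
  rw [A.snd_pull_α hM] at h
  exact (over_ctx_iff (A.models_base hM)).1 h

/-- The extension uses `ftᵐ(Δ)` in place of `Γ`, which loses nothing: since `Δ` occurs in `r`, it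
must lie over `Γ`, and for a context this means `ftᵐ(Δ) = Γ`. This is the clause defining `α` on
`L(σ_m)` in a contextual theory. -/
theorem ev_extendRTerm_and (hM : M.Models A.T.ax) {r : RTerm A.T.sig (V.ext c m) s}
    (hr : r.fv = Set.univ) {Γ : X (c, 1)} {a : X (shift 1 s)} :
    ((extendRTerm A r).Ev M (extVal Δ x) a ∧ FtIter (M.pull A.i) m Δ Γ) ↔
      (lRTerm c r).Ev (M.pull A.α) (consVal Γ (shiftVal Δ x)) a := by
  refine (and_congr_left' (ev_extendRTerm A)).trans ?_
  constructor
  · rintro ⟨⟨γ, hγ, h⟩, hΓ⟩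
    obtain rfl := hγ.unique hΓ
    exact h
  · intro h
    have hΓ : FtIter (M.pull A.i) m Δ Γ := ftIter_of_over A hM
      ((A.closed hM).over_var_of_rterm_ev h (x := (0 : Fin (V.len + 1)))
        (Set.eq_univ_iff_forall.1 hr _))
    exact ⟨⟨Γ, hΓ, h⟩, hΓ⟩

theorem sat_extendFormula_and (hM : M.Models A.T.ax) {φ : Formula A.T.sig (V.ext c m)}
    (hφ : φ.fv = Set.univ) {Γ : X (c, 1)} :
    ((extendFormula A φ).Sat M (extVal Δ x) ∧ FtIter (M.pull A.i) m Δ Γ) ↔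
      (lFormula c φ).Sat (M.pull A.α) (consVal Γ (shiftVal Δ x)) := by
  refine (and_congr_left' (sat_extendFormula A)).trans ?_
  constructor
  · rintro ⟨⟨γ, hγ, h⟩, hΓ⟩
    obtain rfl := hγ.unique hΓ
    exact h
  · intro h
    have hΓ : FtIter (M.pull A.i) m Δ Γ := ftIter_of_over A hM
      ((A.closed hM).over_var_of_sat h (x := (0 : Fin (V.len + 1)))
        (Set.eq_univ_iff_forall.1 hφ _))
    exact ⟨⟨Γ, hΓ, h⟩, hΓ⟩

end Extend

/-! ### The contextual signature of a theory and the translations -/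

/-- The symbols of a signature, with a predicate symbol in place of every function symbol with
target sort `(c, 0)`. -/
abbrev basicSig (c : S₀) (Sg : Signature (S₀ × ℕ)) : Signature (S₀ × ℕ) where
  Func := {σ : Sg.Func // Sg.cod σ ≠ (c, 0)}
  Pred := Sg.Pred ⊕ {σ : Sg.Func // Sg.cod σ = (c, 0)}
  dom σ := Sg.dom σ.1
  cod σ := Sg.cod σ.1
  pdom := Sum.elim Sg.pdom fun σ => Sg.dom σ.1

section Translations

variable (c) in
/-- The restricted term `σ(x₁, …, xₖ)`, in the variables `Δ : (c, 0), x₁, …, xₖ`. -/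
def appOver {Sg : Signature (S₀ × ℕ)} (σ : Sg.Func) :
    RTerm Sg ((Sg.dom σ).ext c 0) (shift 0 (Sg.cod σ)) where
  tm := .app σ fun i => .var (V := (Sg.dom σ).ext c 0) i.succ
  cond := Term.defined (.var (V := (Sg.dom σ).ext c 0) (0 : Fin ((Sg.dom σ).len + 1)))

variable (c) in
/-- The formula `R(x₁, …, xₖ)`, in the variables `Δ : (c, 0), x₁, …, xₖ`. -/
def relOver {Sg : Signature (S₀ × ℕ)} (R : Sg.Pred) : Formula Sg ((Sg.pdom R).ext c 0) :=
  .and (.rel R fun i => .var (V := (Sg.pdom R).ext c 0) i.succ)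
    (Term.defined (.var (V := (Sg.pdom R).ext c 0) (0 : Fin ((Sg.pdom R).len + 1))))

theorem fv_appOver {Sg : Signature (S₀ × ℕ)} (σ : Sg.Func) : (appOver c σ).fv = Set.univ := by
  refine Set.eq_univ_of_forall fun x => ?_
  cases x using Fin.cases with
  | zero => exact Or.inr (Or.inl rfl)
  | succ i => exact Or.inl (Set.mem_iUnion.2 ⟨i, rfl⟩)

theorem fv_relOver {Sg : Signature (S₀ × ℕ)} (R : Sg.Pred) : (relOver c R).fv = Set.univ := by
  refine Set.eq_univ_of_forall fun x => ?_
  cases x using Fin.cases with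
  | zero => exact Or.inr (Or.inl rfl)
  | succ i => exact Or.inl (Set.mem_iUnion.2 ⟨i, rfl⟩)

/-- The variable `Δ` is a dummy; its definedness condition always holds and serves only to make it
occur. -/
theorem ev_appOver {Sg : Signature (S₀ × ℕ)} {X : S₀ × ℕ → Type u} {Q : PStr Sg X} {σ : Sg.Func}
    {d : X (c, 0)} {b : Val X (Sg.dom σ)} {a : X (Sg.cod σ)} :
    (appOver c σ).Ev Q (extVal (V := Sg.dom σ) d b) a ↔ Q.func σ b a := by
  have hv : ∀ i, Term.Ev Q (extVal (V := Sg.dom σ) d b) (s := (Sg.dom σ).sort i)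
      (.var (V := (Sg.dom σ).ext c 0) i.succ) (b i) := fun i => rfl
  have hc : (appOver c σ).cond.Sat Q (extVal (V := Sg.dom σ) d b) := ⟨d, rfl, rfl⟩
  exact (and_iff_left hc).trans (Term.ev_app_vars hv)

theorem sat_relOver {Sg : Signature (S₀ × ℕ)} {X : S₀ × ℕ → Type u} {Q : PStr Sg X} {R : Sg.Pred}
    {d : X (c, 0)} {b : Val X (Sg.pdom R)} :
    (relOver c R).Sat Q (extVal (V := Sg.pdom R) d b) ↔ Q.pred R b := by
  have hv : ∀ i, Term.Ev Q (extVal (V := Sg.pdom R) d b) (s := (Sg.pdom R).sort i)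
      (.var (V := (Sg.pdom R).ext c 0) i.succ) (b i) := fun i => rfl
  refine (and_iff_left ?_).trans (Formula.sat_rel_vars hv)
  exact ⟨d, rfl, rfl⟩

variable {Tb T : PrestableTheory c}

/-- `σ_m(Δ, x₁, …, xₖ)` becomes the `m`-fold extension of `σ(x₁, …, xₖ)`. -/
def fromContextual (f : Translation Tb.T.sig T.T.sig) :
    Translation (contextualSig Tb (basicSig c T.T.sig)) T.T.sig where
  func
    | .inl τ => f.func τ
    | .inr σ => iterRTerm T (appOver c σ.1.1) σ.2
  pred
    | .inl P => f.pred P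
    | .inr (.inl R, m) => iterFormula T (relOver c R) m
    | .inr (.inr σ, m) => iterFormula T (appOver c σ.1).defined m

/-- The constant `*` in a contextual signature. -/
def starTerm (Tb : PrestableTheory c) (B : Signature (S₀ × ℕ)) (V : Ctx (S₀ × ℕ)) :
    RTerm (contextualSig Tb B) V (c, 0) where
  tm := (Tb.i.func .star).inl.tm.subst fun i => Fin.elim0 i
  cond := (Tb.i.func .star).inl.cond.subst fun i => Fin.elim0 i

/-- The terms `*, x₁, …, xₖ`. -/
def putStar (Tb : PrestableTheory c) (B : Signature (S₀ × ℕ)) (V : Ctx (S₀ × ℕ)) :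
    ∀ j : Fin (V.ext c 0).len, Term (contextualSig Tb B) V ((V.ext c 0).sort j) :=
  Fin.cases (motive := fun j => Term (contextualSig Tb B) V ((V.ext c 0).sort j))
    (starTerm Tb B V).tm (fun j => .var j)

open Classical in
/-- `σ(x₁, …, xₖ)` becomes `σ₀(*, x₁, …, xₖ)`, or `*` restricted to the domain of `σ` if the
target sort is `(c, 0)`. -/
noncomputable def toContextual (Tb T : PrestableTheory c) :
    Translation T.T.sig (contextualSig Tb (basicSig c T.T.sig)) where
  func σ :=
    if h : T.T.sig.cod σ = (c, 0) then
      ⟨h ▸ (starTerm Tb _ _).tm,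
        .and (starTerm Tb _ _).cond
          (.rel (Sg := contextualSig Tb (basicSig c T.T.sig)) (.inr (.inr ⟨σ, h⟩, 0))
            (putStar Tb _ _))⟩
    else
      ⟨.app (Sg := contextualSig Tb (basicSig c T.T.sig)) (.inr (⟨σ, h⟩, 0)) (putStar Tb _ _),
        (starTerm Tb _ _).cond⟩
  pred R := .and (starTerm Tb _ _).cond
    (.rel (Sg := contextualSig Tb (basicSig c T.T.sig)) (.inr (.inl R, 0)) (putStar Tb _ _))

theorem fv_defined {S : Type u} {Sg : Signature S} {V : Ctx S} {s : S} {r : RTerm Sg V s}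
    (hr : r.fv = Set.univ) : r.defined.fv = Set.univ :=
  Set.eq_univ_of_forall fun x => (Set.eq_univ_iff_forall.1 hr x).imp Or.inl fun h => h

theorem full_fromContextual {f : Translation Tb.T.sig T.T.sig} (hf : f.Full) :
    (fromContextual f).Full where
  func
    | .inl τ => hf.func τ
    | .inr σ => fv_iterRTerm T (fv_appOver σ.1.1) σ.2
  pred
    | .inl P => hf.pred P
    | .inr (.inl R, m) => fv_iterFormula T (fv_relOver R) m
    | .inr (.inr σ, m) => fv_iterFormula T (fv_defined (fv_appOver σ.1)) m

theorem full_toContextual : (toContextual Tb T).Full where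
  func σ := by
    refine Set.eq_univ_of_forall fun x => ?_
    by_cases h : T.T.sig.cod σ = (c, 0)
    · have e : (toContextual Tb T).func σ = _ := dif_pos h
      rw [e]
      exact Or.inr (Or.inr (Set.mem_iUnion.2 ⟨x.succ, rfl⟩))
    · have e : (toContextual Tb T).func σ = _ := dif_neg h
      rw [e]
      exact Or.inl (Set.mem_iUnion.2 ⟨x.succ, rfl⟩)
  pred R := Set.eq_univ_of_forall fun x => Or.inr (Set.mem_iUnion.2 ⟨x.succ, rfl⟩)

variable {X : S₀ × ℕ → Type u} {V : Ctx (S₀ × ℕ)}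

theorem ev_starTerm {B : Signature (S₀ × ℕ)} {K : PStr (contextualSig Tb B) X} {v : Val X V}
    {d : X (c, 0)} :
    (starTerm Tb B V).Ev K v d ↔ (Tb.i.func .star).Ev K.fst (fun i => Fin.elim0 i) d :=
  (and_congr (Term.ev_subst fun i => Fin.elim0 i) (Formula.sat_subst fun i => Fin.elim0 i)).trans
    RTerm.ev_inl

theorem ev_putStar {B : Signature (S₀ × ℕ)} {K : PStr (contextualSig Tb B) X} {v : Val X V}
    {d : X (c, 0)} (hd : (starTerm Tb B V).Ev K v d) (j : Fin (V.ext c 0).len) :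
    (putStar Tb B V j).Ev K v (extVal (m := 0) d v j) := by
  cases j using Fin.cases with
  | zero => exact hd.1
  | succ j => exact rfl

/-- Going back and forth is the identity if `*` is defined and is the only element of its sort. -/
theorem pull_pull_contextual {f : Translation Tb.T.sig T.T.sig} {Q : PStr T.T.sig X}
    (hd : ∃ d, (Tb.i.func .star).Ev (Q.pull f) (fun i => Fin.elim0 i) d)
    (hsub : ∀ x y : X (c, 0), x = y) :
    (Q.pull (fromContextual f)).pull (toContextual Tb T) = Q := by
  obtain ⟨d, hd⟩ := hd
  have hstar : ∀ {V : Ctx (S₀ × ℕ)} (v : Val X V),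
      (starTerm Tb _ V).Ev (Q.pull (fromContextual f)) v d := fun v => ev_starTerm.2 hd
  ext σ b
  · rename_i a
    by_cases h : T.T.sig.cod σ = (c, 0)
    · have e : (toContextual Tb T).func σ = _ := dif_pos h
      change ((toContextual Tb T).func σ).Ev _ _ _ ↔ _
      rw [e]
      -- Uniqueness is transported to the sort `cod σ`, which equals `(c, 0)` only propositionally.
      -- It lets the domain of `σ` determine its value.
      have hsub' : ∀ {s} (_ : s = (c, 0)) (x y : X s), x = y := by
        rintro _ rfl
        exact hsub
      constructor
      · rintro ⟨-, -, h'⟩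
        have h' := (Formula.sat_rel_vars (ev_putStar (hstar b))).1 h'
        obtain ⟨a', ha'⟩ := RTerm.sat_defined.1 h'
        rw [hsub' h a a']
        exact ev_appOver.1 ha'
      · intro h'
        refine ⟨(Term.ev_cast h).2 ?_, (hstar b).2,
          (Formula.sat_rel_vars (ev_putStar (hstar b))).2
            (RTerm.sat_defined.2 ⟨a, ev_appOver.2 h'⟩)⟩
        rw [hsub (h ▸ a) d]
        exact (hstar b).1
    · have e : (toContextual Tb T).func σ = _ := dif_neg h
      change ((toContextual Tb T).func σ).Ev _ _ _ ↔ _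
      rw [e]
      refine Iff.trans ?_ (ev_appOver (d := d) (b := b))
      exact (and_iff_left (hstar b).2).trans (Term.ev_app_vars (ev_putStar (hstar b)))
  · refine Iff.trans ?_ (sat_relOver (d := d) (b := b))
    exact (and_iff_right (hstar b).2).trans (Formula.sat_rel_vars (ev_putStar (hstar b)))

theorem pull_contextualI {B : Signature (S₀ × ℕ)} {K : PStr (contextualSig Tb B) X} :
    K.pull (contextualI Tb B) = K.fst.pull Tb.i := by
  ext σ b
  · exact RTerm.ev_inl
  · exact Formula.sat_inl

theorem full_contextualI {B : Signature (S₀ × ℕ)} : (contextualI Tb B).Full where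
  func σ := (RTerm.fv_inl _).trans (Tb.i_int.fv_func σ)
  pred σ := (Formula.fv_inl _).trans (Tb.i_int.fv_pred σ)

theorem ev_dropΓ {Sg : Signature (S₀ × ℕ)} {m : ℕ} {K : PStr Sg X} {Γ : X (c, 1)}
    {Δ : X (c, m + 1)} {x : Val X ⟨V.len, fun i => shift (m + 1) (V.sort i)⟩}
    (j : Fin (V.ext c (m + 1)).len) :
    (dropΓ Sg V m j).Ev K (consVal Γ (shiftVal Δ x) : Val X ((V.ext c m).ext c 1))
      (extVal Δ x j) := by
  cases j using Fin.cases <;> exact rfl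

theorem sat_ftEqΓ {B : Signature (S₀ × ℕ)} {m : ℕ} {K : PStr (contextualSig Tb B) X}
    {Γ : X (c, 1)} {Δ : X (c, m + 1)} {x : Val X ⟨V.len, fun i => shift (m + 1) (V.sort i)⟩} :
    (ftEqΓ Tb B V m).Sat K (consVal Γ (shiftVal Δ x)) ↔ FtIter (K.fst.pull Tb.i) m Δ Γ := by
  refine (Formula.sat_inl.trans Tb.i_int.full.sat_mapFormula).trans ?_
  constructor
  · rintro ⟨g, h, h'⟩
    obtain ⟨a, ha, h⟩ := (ev_ftIter ev_baseFt).1 h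
    have ha : a = Δ := ha
    have h' : g = Γ := h'
    exact ha ▸ h' ▸ h
  · intro h
    exact ⟨Γ, (ev_ftIter ev_baseFt).2 ⟨Δ, rfl, h⟩, rfl⟩

theorem zero_mem_fv_ftEqΓ {B : Signature (S₀ × ℕ)} {m : ℕ} :
    (0 : Fin (V.len + 1 + 1)) ∈ (ftEqΓ Tb B V m).fv := by
  refine (Formula.fv_inl (Sg' := familySig c B) _).symm ▸ ?_
  exact Tb.i_int.full.mem_fv_mapFormula (Or.inr rfl)

theorem full_contextualα {B : Signature (S₀ × ℕ)} : (contextualα Tb B).Full where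
  func
    | .inl (.inl τ) => (RTerm.fv_inl _).trans (Tb.α_int.fv_func _)
    | .inl (.inr σ) => Set.eq_univ_of_forall fun x => by
        cases x using Fin.cases with
        | zero => exact Or.inr zero_mem_fv_ftEqΓ
        | succ x => cases x using Fin.cases with
          | zero => exact Or.inl (Set.mem_iUnion.2 ⟨(0 : Fin ((B.dom σ.1).len + 1)), rfl⟩)
          | succ x => exact Or.inl (Set.mem_iUnion.2 ⟨x.succ, rfl⟩)
    | .inr b => (RTerm.fv_inl _).trans (Tb.α_int.fv_func _)
  pred
    | .inl (.inl P) => (Formula.fv_inl _).trans (Tb.α_int.fv_pred _)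
    | .inl (.inr R) => Set.eq_univ_of_forall fun x => by
        cases x using Fin.cases with
        | zero => exact Or.inr zero_mem_fv_ftEqΓ
        | succ x => cases x using Fin.cases with
          | zero => exact Or.inl (Set.mem_iUnion.2 ⟨(0 : Fin ((B.pdom R.1).len + 1)), rfl⟩)
          | succ x => exact Or.inl (Set.mem_iUnion.2 ⟨x.succ, rfl⟩)
    | .inr b => (Formula.fv_inl _).trans (Tb.α_int.fv_pred _)

end Translations

/-! ### The contextual theory -/

section Main

variable {Tb T : PrestableTheory c} {f : Translation Tb.T.sig T.T.sig}
  (hf : PrestableTheory.IsHom Tb T f) {X : S₀ × ℕ → Type u} {M : PStr T.T.sig X}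
  (hM : M.Models T.T.ax)

section Pull

include hf hM

theorem PrestableTheory.IsHom.pull_i : (M.pull f).pull Tb.i = M.pull T.i := by
  rw [← hf.int.full.pull_comp, hf.under.pull_eq hM]

theorem PrestableTheory.IsHom.pull_α :
    (M.pull f).pull Tb.α = (M.pull T.α).pull (LTranslation c f) := by
  rw [← hf.int.full.pull_comp, hf.alg.pull_eq hM, T.α_int.full.pull_comp]

/-- On symbols of `Tb` this is the compatibility of `f` with the algebra structures. On `L(σ_m)` and
`L(R_m)` it holds by construction, as the reading of the symbol with index `m + 1` is the extension
of that with index `m`. -/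
theorem pull_contextualα :
    (M.pull (fromContextual f)).pull (contextualα Tb (basicSig c T.T.sig)) =
      (M.pull T.α).pull (LTranslation c (fromContextual f)) := by
  have hα := hf.pull_α hM
  refine PStr.sum_ext ?_ ?_
  · ext σ v
    · rename_i a
      rcases σ with τ | ⟨σ, m⟩
      · refine RTerm.ev_inl.trans ?_
        exact Iff.of_eq (congrFun (congrFun (congrFun (congrArg PStr.func hα) (.inl τ)) v) a)
      · obtain ⟨Γ, w, rfl⟩ := exists_eq_consVal v
        obtain ⟨Δ, x, rfl⟩ := exists_eq_shiftVal (V := T.T.sig.dom σ.1) w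
        have h1 : _ ↔ FtIter ((M.pull f).pull Tb.i) m Δ Γ :=
          sat_ftEqΓ (K := M.pull (fromContextual f)) (V := T.T.sig.dom σ.1) (x := x)
        rw [hf.pull_i hM] at h1
        refine (and_congr (Term.ev_app_vars ev_dropΓ) h1).trans ?_
        exact ev_extendRTerm_and T (V := T.T.sig.dom σ.1) hM (fv_iterRTerm T (fv_appOver σ.1) m)
    · rcases σ with P | ⟨R | σ, m⟩
      · refine Formula.sat_inl.trans ?_
        exact Iff.of_eq (congrFun (congrFun (congrArg PStr.pred hα) (.inl P)) v)
      · obtain ⟨Γ, w, rfl⟩ := exists_eq_consVal v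
        obtain ⟨Δ, x, rfl⟩ := exists_eq_shiftVal (V := T.T.sig.pdom R) w
        have h1 : _ ↔ FtIter ((M.pull f).pull Tb.i) m Δ Γ :=
          sat_ftEqΓ (K := M.pull (fromContextual f)) (V := T.T.sig.pdom R) (x := x)
        rw [hf.pull_i hM] at h1
        refine (and_congr (Formula.sat_rel_vars ev_dropΓ) h1).trans ?_
        exact sat_extendFormula_and T (V := T.T.sig.pdom R) hM
          (fv_iterFormula T (fv_relOver R) m)
      · obtain ⟨Γ, w, rfl⟩ := exists_eq_consVal v
        obtain ⟨Δ, x, rfl⟩ := exists_eq_shiftVal (V := T.T.sig.dom σ.1) w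
        have h1 : _ ↔ FtIter ((M.pull f).pull Tb.i) m Δ Γ :=
          sat_ftEqΓ (K := M.pull (fromContextual f)) (V := T.T.sig.dom σ.1) (x := x)
        rw [hf.pull_i hM] at h1
        refine (and_congr (Formula.sat_rel_vars ev_dropΓ) h1).trans ?_
        exact sat_extendFormula_and T (V := T.T.sig.dom σ.1) hM
          (fv_iterFormula T (fv_defined (fv_appOver σ.1)) m)
  · have hs := congrArg PStr.snd hα
    rw [snd_pull_LTranslation] at hs
    -- Both sides have the same base part because `L` of a translation fixes the base symbols.
    rw [snd_pull_LTranslation, ← hs]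
    ext b v
    · exact RTerm.ev_inl
    · exact Formula.sat_inl

end Pull

variable (Tb T f) in
/-- The sequents that become theorems of `T`. -/
def pulledAx : Set (Sequent (contextualSig Tb (basicSig c T.T.sig))) :=
  {q | Derivable T.T.ax ((fromContextual f).mapFormula q.lhs) ((fromContextual f).mapFormula q.rhs)}

variable (Tb T f) in
/-- The structures pulled back from models of `T`. -/
def IsPulled (X : S₀ × ℕ → Type u) (K : PStr (contextualSig Tb (basicSig c T.T.sig)) X) : Prop :=
  ∃ M : PStr T.T.sig X, M.Models T.T.ax ∧ K = M.pull (fromContextual f)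

include hf in
-- A sequent valid in all pulled back structures has a translation valid in all models of `T`, hence
-- derivable in `T`; so it is itself an axiom.
theorem completeFor_pulledAx : CompleteFor (pulledAx Tb T f) (IsPulled Tb T f) := by
  have hfull := full_fromContextual hf.int.full
  refine ⟨fun {V φ ψ} h => .ax ((completeFor_models T.T.ax).derivable fun X M hM v hl => ?_)⟩
  exact hfull.sat_mapFormula.2 (h X _ ⟨M, hM, rfl⟩ v (hfull.sat_mapFormula.1 hl))

include hf hM in
theorem models_pulledAx : (M.pull (fromContextual f)).Models (pulledAx Tb T f) := by
  have hfull := full_fromContextual hf.int.full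
  exact fun q hq v hl => hfull.sat_mapFormula.1 (hq.sound hM v (hfull.sat_mapFormula.2 hl))

include hf hM in
theorem closed_fromContextual :
    Closed ((M.pull T.α).pull (LTranslation c (fromContextual f))) :=
  (T.closed hM).pull (full_fromContextual hf.int.full)

include hf hM in
-- On the symbols of `Tb`, `fromContextual` is `f`; slicing reduces the claim to this.
theorem slice_fromContextual {Γ : X (c, 1)} :
    (slice (M.pull T.i) Γ ((M.pull T.α).pull (LTranslation c (fromContextual f)))).fst =
      slice (M.pull T.i) Γ ((M.pull f).pull Tb.α) := by
  rw [hf.pull_α hM, slice_pull (T.closed hM) (T.snd_pull_α hM),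
    slice_pull (T.closed hM) (T.snd_pull_α hM)]
  rfl

include hM in
theorem snd_pull_fromContextual :
    ((M.pull T.α).pull (LTranslation c (fromContextual f))).snd = M.pull T.i := by
  rw [snd_pull_LTranslation, T.snd_pull_α hM]

/-- The contextual theory of the sequents that become theorems of `T`. -/
def contextualTheory : ContextualTheory Tb where
  basic := basicSig c T.T.sig
  cod_ne σ := σ.2
  ax := pulledAx Tb T f
  ax_base q hq := (completeFor_models T.T.ax).derivable fun X M hM v hl => by
    have hfull := full_fromContextual hf.int.full
    refine hfull.sat_mapFormula.2 (Formula.sat_inl.2 ?_)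
    exact hf.int.models_pull hM q hq v (Formula.sat_inl.1 (hfull.sat_mapFormula.1 hl))
  i_int := (completeFor_pulledAx hf).isInterpretation full_contextualI <| by
    rintro X _ ⟨M, hM, rfl⟩
    rw [pull_contextualI]
    exact Tb.models_base (hf.int.models_pull hM)
  α_int := (completeFor_pulledAx hf).isInterpretation full_contextualα <| by
    rintro X _ ⟨M, hM, rfl⟩
    have hMf := hf.int.models_pull hM
    rw [pull_contextualα hf hM]
    refine models_LAx_iff.2 ⟨?_, closed_fromContextual hf hM, ?_⟩
    · rw [snd_pull_fromContextual hM]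
      exact T.models_base hM
    · rw [snd_pull_fromContextual hM]
      intro p n Γ x
      -- The operations `ctx` are interpreted through `Tb`, so their compatibility is inherited from
      -- the model of `Tb` obtained by pulling back along `f`.
      have h := Tb.ctxCompat hMf
      rw [hf.pull_i hM] at h
      obtain ⟨y, hy, h⟩ := h p n Γ x
      rw [← slice_fromContextual hf hM] at h
      exact ⟨y, hy, RTerm.ev_inl.2 h⟩
  α_under := (completeFor_pulledAx hf).translation_equiv <| by
    rintro X _ ⟨M, hM, rfl⟩
    rw [full_contextualα.pull_comp, PStr.pull_inr, pull_contextualα hf hM,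
      snd_pull_fromContextual hM, pull_contextualI, ← hf.pull_i hM]
    rfl

theorem full_inl {S : Type u} (Sg Sg' : Signature S) : (Translation.inl Sg Sg').Full where
  func _ := Set.eq_univ_of_forall fun x => Or.inl (Set.mem_iUnion.2 ⟨x, rfl⟩)
  pred _ := Set.eq_univ_of_forall fun x => Set.mem_iUnion.2 ⟨x, rfl⟩

include hf hM in
theorem pull_LTranslation_inl :
    ((M.pull T.α).pull (LTranslation c (fromContextual f))).pull
      (LTranslation c (Translation.inl Tb.T.sig (familySig c (basicSig c T.T.sig)))) =
      (M.pull f).pull Tb.α := by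
  have hMf := hf.int.models_pull hM
  have hs : ((M.pull f).pull Tb.α).snd = M.pull T.i := by
    rw [Tb.snd_pull_α hMf, hf.pull_i hM]
  have hcl := closed_fromContextual hf hM
  refine (Closed.ext (Tb.closed hMf) (hcl.pull (full_inl _ _)) ?_ fun Γ => ?_).symm
  · rw [hs, snd_pull_LTranslation, snd_pull_fromContextual hM]
  · rw [hs, slice_pull hcl (snd_pull_fromContextual hM), PStr.pull_inl,
      slice_fromContextual hf hM]

theorem isHom_incl :
    PrestableTheory.IsHom Tb (contextualTheory hf).toPrestable (contextualTheory hf).incl := by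
  have hfull := full_inl Tb.T.sig (familySig c (basicSig c T.T.sig))
  refine ⟨(completeFor_pulledAx hf).isInterpretation hfull ?_,
    (completeFor_pulledAx hf).translation_equiv ?_, (completeFor_pulledAx hf).translation_equiv ?_⟩
  · rintro X _ ⟨M, hM, rfl⟩
    have h := hf.int.models_pull hM
    have e : (M.pull (fromContextual f)).pull (Translation.inl _ _) = M.pull f := PStr.pull_inl
    rw [← e] at h
    exact h
  · rintro X _ ⟨M, hM, rfl⟩
    exact (hfull.pull_comp.trans (congrArg _ PStr.pull_inl)).trans pull_contextualI.symm
  · rintro X _ ⟨M, hM, rfl⟩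
    refine Eq.trans ?_ full_contextualα.pull_comp.symm
    refine (hfull.pull_comp.trans (congrArg _ PStr.pull_inl)).trans ?_
    exact (pull_LTranslation_inl hf hM).symm.trans
      (congrArg (PStr.pull _) (pull_contextualα hf hM).symm)

theorem isHom_fromContextual :
    PrestableTheory.IsHom (contextualTheory hf).toPrestable T (fromContextual f) := by
  have hfull := full_fromContextual hf.int.full
  refine ⟨(completeFor_models _).isInterpretation hfull fun X M hM => models_pulledAx hf hM,
    (completeFor_models _).translation_equiv fun X M hM => ?_,
    (completeFor_models _).translation_equiv fun X M hM => ?_⟩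
  · exact hfull.pull_comp.trans (pull_contextualI.trans (hf.pull_i hM))
  · exact hfull.pull_comp.trans ((pull_contextualα hf hM).trans T.α_int.full.pull_comp.symm)

include hf hM in
theorem pull_pull_model :
    (M.pull (fromContextual f)).pull (toContextual Tb T) = M := by
  have hB := T.models_base hM
  obtain ⟨d, hd⟩ := exists_star hB
  rw [← hf.pull_i hM] at hd
  exact pull_pull_contextual ⟨d, hd⟩ (eq_of_length_zero hB)

include hf hM in
-- The slice need not satisfy the base axioms, so the existence and uniqueness of `*` in it are
-- proved separately.
theorem pull_pull_slice (hTb : Tb.EmptyCtxExtends) {Γ : X (c, 1)} :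
    ((slice (M.pull T.i) Γ (M.pull T.α)).pull (fromContextual f)).pull (toContextual Tb T) =
      slice (M.pull T.i) Γ (M.pull T.α) := by
  have hMf := hf.int.models_pull hM
  have hB := T.models_base hM
  refine pull_pull_contextual ?_ fun x y => Subtype.ext ?_
  -- The value of `α(L(Γ, *))` in the model of `Tb` is the element `*` of the slice over `Γ`. This
  -- is where the extendability of the empty context is used.
  · obtain ⟨a, ha⟩ := RTerm.sat_defined.1 (hTb.sound hMf
      (sliceVal (V := Ctx.empty _) (B := M.pull T.i) (Γ := Γ) fun i => Fin.elim0 i) trivial)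
    have ha := Tb.α_int.full.ev_mapRTerm.1 ha
    obtain ⟨ho, h⟩ := ((Tb.closed hMf).ev_lRTerm
      ((Tb.snd_pull_α hMf).trans (hf.pull_i hM))).1 ha
    rw [hf.pull_α hM, slice_pull (T.closed hM) (T.snd_pull_α hM)] at h
    exact ⟨⟨a, ho⟩, h⟩
  -- At length zero the iterate of `ft` is empty, so lying over `Γ` means being equal to `Γ`.
  · have hx : x.1 = Γ := (over_ctx_iff hB).1 x.2
    have hy : y.1 = Γ := (over_ctx_iff hB).1 y.2
    exact hx.trans hy.symm

include hf hM in
theorem pull_LTranslation_toContextual (hTb : Tb.EmptyCtxExtends) :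
    ((M.pull T.α).pull (LTranslation c (fromContextual f))).pull
      (LTranslation c (toContextual Tb T)) = M.pull T.α := by
  have hcl := closed_fromContextual hf hM
  refine (Closed.ext (T.closed hM) (hcl.pull full_toContextual) ?_ fun Γ => ?_).symm
  · rw [snd_pull_LTranslation, snd_pull_LTranslation]
  · rw [T.snd_pull_α hM, slice_pull hcl (snd_pull_fromContextual hM),
      slice_pull (T.closed hM) (T.snd_pull_α hM), pull_pull_slice hf hM hTb]

/-- Pulling a structure of the form `M.pull (fromContextual f)` back along `toContextual` returns
the model `M`, which gives the first two conditions. Compatibility with `α` is the same statement in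
every slice. -/
theorem isHom_toContextual (hTb : Tb.EmptyCtxExtends) :
    PrestableTheory.IsHom T (contextualTheory hf).toPrestable (toContextual Tb T) := by
  refine ⟨(completeFor_pulledAx hf).isInterpretation full_toContextual ?_,
    (completeFor_pulledAx hf).translation_equiv ?_, (completeFor_pulledAx hf).translation_equiv ?_⟩
  · rintro X _ ⟨M, hM, rfl⟩
    have h := hM
    rw [← pull_pull_model hf hM] at h
    exact h
  · rintro X _ ⟨M, hM, rfl⟩
    refine Eq.trans ?_ pull_contextualI.symm
    refine (full_toContextual.pull_comp.trans (congrArg _ (pull_pull_model hf hM))).trans ?_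
    exact (hf.pull_i hM).symm
  · rintro X _ ⟨M, hM, rfl⟩
    refine Eq.trans ?_ full_contextualα.pull_comp.symm
    refine (full_toContextual.pull_comp.trans (congrArg _ (pull_pull_model hf hM))).trans ?_
    exact (pull_LTranslation_toContextual hf hM hTb).symm.trans
      (congrArg (PStr.pull _) (pull_contextualα hf hM).symm)

theorem isoUnder_contextualTheory (hTb : Tb.EmptyCtxExtends) :
    PrestableTheory.IsoUnder Tb T (contextualTheory hf).toPrestable f
      (contextualTheory hf).incl := by
  have hfull := full_fromContextual hf.int.full
  refine ⟨toContextual Tb T, fromContextual f, isHom_toContextual hf hTb, isHom_fromContextual hf,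
    (completeFor_models _).translation_equiv fun X M hM => ?_,
    (completeFor_pulledAx hf).translation_equiv ?_, (completeFor_pulledAx hf).translation_equiv ?_,
    (completeFor_models _).translation_equiv fun X M hM => ?_⟩
  · exact hfull.pull_comp.trans ((pull_pull_model hf hM).trans M.pull_id.symm)
  -- The other composite needs no new computation: the structures to be tested are pulled back from
  -- models `M`, and `M` is recovered from them.
  · rintro X _ ⟨M, hM, rfl⟩
    exact (full_toContextual.pull_comp.trans (congrArg _ (pull_pull_model hf hM))).trans
      (PStr.pull_id _).symm
  · rintro X _ ⟨M, hM, rfl⟩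
    have e : (M.pull (fromContextual f)).pull (Translation.inl _ _) = M.pull f := PStr.pull_inl
    exact (full_toContextual.pull_comp.trans (congrArg _ (pull_pull_model hf hM))).trans e.symm
  · exact hfull.pull_comp.trans PStr.pull_inl

end Main

end PartialHorn

theorem mainTheorem4 {S₀ : Type u} (c : S₀)
    (Tb T : PartialHorn.PrestableTheory c) (hTb : Tb.EmptyCtxExtends)
    (f : PartialHorn.Translation Tb.T.sig T.T.sig)
    (hf : PartialHorn.PrestableTheory.IsHom Tb T f) :
    ∃ C : PartialHorn.ContextualTheory Tb,
      PartialHorn.PrestableTheory.IsHom Tb C.toPrestable C.incl ∧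
      PartialHorn.PrestableTheory.IsoUnder Tb T C.toPrestable f C.incl :=
  ⟨PartialHorn.contextualTheory hf, PartialHorn.isHom_incl hf,
    PartialHorn.isoUnder_contextualTheory hf hTb⟩
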